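/- Let $k\ge 1$ and $r\ge 3$ be integers, and put $c_3=128\,r^{r+3}$ and $c_4=\log(64\,r^{r+2})$, where $\log$ is the logarithm to base $2$. An $r$-graph is a finite hypergraph $G$ in which every edge has exactly $r$ vertices; it is linear if any two distinct edges share at most one vertex, and $r$-partite if its vertex set can be partitioned into $r$ sets such that every edge contains exactly one vertex of each. A linear cycle of length $m\ge 3$ in $G$ consists of $m$ edges $e_1,\dots,e_m$ of $G$, with $(r-1)m$ vertices in total, such that $|e_i\cap e_{j}|=1$ if $j\equiv i\pm1 \pmod m$ and $e_i\cap e_j=\emptyset$ for all other $j\neq i$. Let $G$ be an $n$-vertex $r$-partite linear $r$-graph whose average degree $d=d(G)$ satisfies $d\ge c_3k$. Then there is a positive integer $$\ell\le\left\lceil\frac{\log n}{\log(d/k)-c_4}\right\rceil-1$$ such that $G$ contains linear cycles of each of the lengths $2\ell+2,\,2\ell+4,\,\dots,\,2\ell+2k$. -/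

import Mathlib

namespace Hypergraph

variable {α : Type*}

/-- An `r`-graph: every edge has exactly `r` vertices. -/
def IsRGraph (H : Hypergraph α) (r : ℕ) : Prop :=
  ∀ e ∈ H.edgeSet, e.ncard = r

/-- Any two distinct edges share at most one vertex (meant for hypergraphs with finite edges). -/
def IsLinear (H : Hypergraph α) : Prop :=
  ∀ e ∈ H.edgeSet, ∀ f ∈ H.edgeSet, e ≠ f → (e ∩ f).ncard ≤ 1

/-- The vertex set splits into `r` disjoint parts such that every edge has exactly one vertex in
each part. -/
def IsRPartite (H : Hypergraph α) (r : ℕ) : Prop :=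
  ∃ A : Fin r → Set α,
    (∀ i j, i ≠ j → Disjoint (A i) (A j)) ∧
    (⋃ i, A i) = H.vertexSet ∧
    ∀ e ∈ H.edgeSet, ∀ i, (e ∩ A i).ncard = 1

/-- The number of edges containing `v`. -/
noncomputable def degree (H : Hypergraph α) (v : α) : ℕ :=
  {e | e ∈ H.edgeSet ∧ v ∈ e}.ncard

/-- The average degree over all vertices (meant for a finite vertex set). -/
noncomputable def averageDegree (H : Hypergraph α) : ℝ :=
  (∑ᶠ v ∈ H.vertexSet, (H.degree v : ℝ)) / (H.vertexSet.ncard : ℝ)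

/-- `H` contains an `r`-uniform linear cycle of length `m`: there are `m` distinct edges
`e 0, …, e (m - 1)` of `H`, each with `r` vertices and with `(r - 1) * m` vertices altogether, such
that cyclically consecutive ones share exactly one vertex and all other pairs are disjoint. -/
def ContainsLinearCycle (H : Hypergraph α) (r m : ℕ) : Prop :=
  3 ≤ m ∧ ∃ e : Fin m → Set α,
    Function.Injective e ∧
    (∀ i, e i ∈ H.edgeSet ∧ (e i).ncard = r) ∧
    (⋃ i, e i).ncard = (r - 1) * m ∧
    (∀ i j : Fin m, ((i : ℕ) + 1) % m = (j : ℕ) → (e i ∩ e j).ncard = 1) ∧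
    (∀ i j : Fin m, i ≠ j → ((i : ℕ) + 1) % m ≠ (j : ℕ) → ((j : ℕ) + 1) % m ≠ (i : ℕ) →
      Disjoint (e i) (e j))

end Hypergraph

/-! Let `D = d / (64 k r ^ (r + 2))`. Some nonempty subfamily of the edges has minimum degree at
least `d / r` on the vertices it covers. In it a tree of edges is grown from one vertex, level by
level. A new level consists of the new vertices of edges that leave the last level and are pairwise
disjoint outside the tree, and it is at least `D` times as large as the last one. Since the levels
cannot outgrow the vertex set, `TreeLevel.step` must fail at some height. Failure means that too
many edges meet the enlarged tree twice: either edges from the last level `M` to the fresh vertices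
`N`, or edges with two vertices in `N`.

Such a dense family is treated as a bipartite graph by choosing two ends `x e`, `y e` of each edge.
Suppose the ends `x e` form a set `X` of one colour inside a level, with ancestors of one colour at
each level. Then `X` has a lowest common ancestor. Separating one branch at that ancestor from the
others colours `X` so that vertices of different classes are joined through the tree by linear paths
of one length `2 * ℓ` (`Splits`, `splits_succ`).

The crossing lemma `exists_crossing` gives a core of large minimum degree whose ends `x e` all have
one class, and an edge from the other class touching it. A path that starts with this edge and
continues greedily in the core is back among the ends `x e` after `2 * i` edges, always in the class
opposite to its start. For each `i ≤ k` the tree closes it to a cycle of length `2 * ℓ + 2 * i`,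
with the same `ℓ` (`exists_linear_cycles`). The growth of the levels yields `D ^ ℓ < n`, which is
the bound on `ℓ`. -/

namespace LinearCycles

/-! ### Linear paths, and gluing two of them into a linear cycle -/

/-- The edges `e 0, …, e (m - 1)` of `E` form a linear path through the vertices `v 0, …, v m`. -/
structure LinearPath {α : Type*} (E : Finset (Finset α)) (e : ℕ → Finset α) (v : ℕ → α)
    (m : ℕ) : Prop where
  mem : ∀ i < m, e i ∈ E
  left : ∀ i < m, v i ∈ e i
  right : ∀ i < m, v (i + 1) ∈ e i
  inter : ∀ i j, i < j → j < m → ∀ u, u ∈ e i → u ∈ e j → j = i + 1 ∧ u = v j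
  inj : ∀ i j, i < j → j ≤ m → v i ≠ v j

/-- `E` contains a linear path with `m` edges from `a` to `b` whose edges have union `U`. -/
def PathBetween {α : Type*} (E : Finset (Finset α)) (a b : α) (m : ℕ) (U : Set α) : Prop :=
  ∃ e v, LinearPath E e v m ∧ v 0 = a ∧ v m = b ∧ ∀ u, u ∈ U ↔ ∃ i < m, u ∈ e i

/-- `E` contains a linear cycle of length `m`, whose edges cover `(r - 1) * m` vertices. -/
def HasLinearCycle {α : Type*} [DecidableEq α] (E : Finset (Finset α)) (r m : ℕ) : Prop :=
  3 ≤ m ∧ ∃ e : Fin m → Finset α, Function.Injective e ∧ (∀ i, e i ∈ E) ∧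
    (Finset.univ.biUnion e).card = (r - 1) * m ∧
    (∀ i j : Fin m, ((i : ℕ) + 1) % m = (j : ℕ) → (e i ∩ e j).card = 1) ∧
    (∀ i j : Fin m, i ≠ j → ((i : ℕ) + 1) % m ≠ (j : ℕ) → ((j : ℕ) + 1) % m ≠ (i : ℕ) →
      Disjoint (e i) (e j))

variable {α : Type*} {E : Finset (Finset α)}

theorem PathBetween.nil (a : α) : PathBetween E a a 0 ∅ :=
  ⟨fun _ => ∅, fun _ => a, ⟨by simp, by simp, by simp, by simp, by intro i j _ _; omega⟩, rfl, rfl,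
    by simp⟩

theorem PathBetween.snoc {a b c : α} {m : ℕ} {U : Set α} (h : PathBetween E a b m U)
    {f : Finset α} (hf : f ∈ E) (hb : b ∈ f) (hc : c ∈ f) (hcb : c ≠ b)
    (hU : ∀ u ∈ f, u ∈ U → u = b) : PathBetween E a c (m + 1) (U ∪ f) := by
  obtain ⟨e, v, h, rfl, rfl, hUe⟩ := h
  refine ⟨fun i => if i < m then e i else f, fun i => if i ≤ m then v i else c,
    ⟨?_, ?_, ?_, ?_, ?_⟩, by simp, by simp, ?_⟩
  · intro i hi
    by_cases him : i < m
    · simpa [him] using h.mem i him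
    · simpa [him] using hf
  · intro i hi
    by_cases him : i < m
    · simpa [him, him.le] using h.left i him
    · obtain rfl : i = m := by omega
      simpa using hb
  · intro i hi
    by_cases him : i < m
    · simpa [him, Nat.succ_le_iff] using h.right i him
    · obtain rfl : i = m := by omega
      simpa using hc
  · intro i j hij hj u hui huj
    have him : i < m := by omega
    simp only [him, if_true] at hui
    by_cases hjm : j < m
    · simp only [hjm, if_true] at huj
      simpa [hjm.le] using h.inter i j hij hjm u hui huj
    · obtain rfl : j = m := by omega
      simp only [lt_irrefl, if_false] at huj
      have hu := hU u huj ((hUe u).2 ⟨i, him, hui⟩)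
      simp only [le_refl, if_true]
      refine ⟨?_, hu⟩
      by_contra hne
      have h1 : v j ∈ e (j - 1) := by
        have := h.right (j - 1) (by omega)
        rwa [Nat.sub_add_cancel (by omega)] at this
      have := (h.inter i (j - 1) (by omega) (by omega) u hui (hu ▸ h1)).2
      exact h.inj (j - 1) j (by omega) le_rfl (this.symm.trans hu)
  · intro i j hij hj
    have him : i ≤ m := by omega
    by_cases hjm : j ≤ m
    · simpa [him, hjm] using h.inj i j hij hjm
    · simp only [him, hjm, if_true, if_false]
      rintro rfl
      by_cases hi : i < m
      · exact hcb (hU _ hc ((hUe _).2 ⟨i, hi, h.left i hi⟩))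
      · obtain rfl : i = m := by omega
        exact hcb rfl
  · intro u
    constructor
    · rintro (hu | hu)
      · obtain ⟨i, hi, hu⟩ := (hUe u).1 hu
        exact ⟨i, by omega, by simpa [hi] using hu⟩
      · exact ⟨m, by omega, by simpa using hu⟩
    · rintro ⟨i, hi, hu⟩
      by_cases him : i < m
      · exact Or.inl ((hUe u).2 ⟨i, him, by simpa [him] using hu⟩)
      · exact Or.inr (by simpa [him] using hu)

theorem PathBetween.symm {a b : α} {m : ℕ} {U : Set α} (h : PathBetween E a b m U) :
    PathBetween E b a m U := by
  obtain ⟨e, v, h, rfl, rfl, hUe⟩ := h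
  refine ⟨fun i => e (m - 1 - i), fun i => v (m - i), ⟨?_, ?_, ?_, ?_, ?_⟩, by simp, by simp, ?_⟩
  · intro i hi
    exact h.mem _ (by omega)
  · intro i hi
    have := h.right (m - 1 - i) (by omega)
    rwa [show m - 1 - i + 1 = m - i by omega] at this
  · intro i hi
    have := h.left (m - 1 - i) (by omega)
    rwa [show m - 1 - i = m - (i + 1) by omega] at this ⊢
  · intro i j hij hj u hui huj
    obtain ⟨h1, h2⟩ := h.inter (m - 1 - j) (m - 1 - i) (by omega) (by omega) u huj hui
    obtain rfl : j = i + 1 := by omega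
    exact ⟨rfl, by rwa [show m - 1 - i = m - (i + 1) by omega] at h2⟩
  · intro i j hij hj
    exact (h.inj (m - j) (m - i) (by omega) (by omega)).symm
  · intro u
    rw [hUe]
    constructor
    · rintro ⟨i, hi, hu⟩
      exact ⟨m - 1 - i, by omega, by simpa [show m - 1 - (m - 1 - i) = i by omega] using hu⟩
    · rintro ⟨i, hi, hu⟩
      exact ⟨m - 1 - i, by omega, hu⟩

theorem PathBetween.right_mem {a b : α} {m : ℕ} {U : Set α} (h : PathBetween E a b m U)
    (hm : 0 < m) : b ∈ U := by
  obtain ⟨e, v, h, rfl, rfl, hUe⟩ := h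
  refine (hUe _).2 ⟨m - 1, by omega, ?_⟩
  have := h.right (m - 1) (by omega)
  rwa [Nat.sub_add_cancel hm] at this

theorem hasLinearCycle_of_cyclic [DecidableEq α] {r n : ℕ} (hr : ∀ f ∈ E, f.card = r)
    (hn : 3 ≤ n) (e : ℕ → Finset α) (v : ℕ → α) (hE : ∀ i < n, e i ∈ E)
    (hl : ∀ i < n, v i ∈ e i) (hrt : ∀ i < n, v ((i + 1) % n) ∈ e i)
    (hI : ∀ i j, i < j → j < n → ∀ u, u ∈ e i → u ∈ e j →
      (j = i + 1 ∧ u = v j) ∨ (i = 0 ∧ j + 1 = n ∧ u = v 0))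
    (hV : ∀ i j, i < j → j < n → v i ≠ v j) : HasLinearCycle E r n := by
  have hV' : ∀ i < n, ∀ j < n, v i = v j → i = j := by
    intro i hi j hj h
    rcases lt_trichotomy i j with hij | hij | hij
    · exact absurd h (hV i j hij hj)
    · exact hij
    · exact absurd h.symm (hV j i hij hi)
  have nx : ∀ i < n, (i + 1 < n ∧ (i + 1) % n = i + 1) ∨ (i + 1 = n ∧ (i + 1) % n = 0) := by
    intro i hi
    rcases Nat.lt_or_ge (i + 1) n with h | h
    · exact Or.inl ⟨h, Nat.mod_eq_of_lt h⟩
    · have : i + 1 = n := by omega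
      exact Or.inr ⟨this, by rw [this, Nat.mod_self]⟩
  have hsub : ∀ i < n, ∀ j < n, i ≠ j → ∀ u, u ∈ e i → u ∈ e j →
      ((i + 1) % n = j ∧ u = v j) ∨ ((j + 1) % n = i ∧ u = v i) := by
    intro i hi j hj hij u hui huj
    rcases lt_or_gt_of_ne hij with h | h
    · rcases hI i j h hj u hui huj with ⟨h1, h2⟩ | ⟨h1, h2, h3⟩
      · left; refine ⟨?_, h2⟩; rw [Nat.mod_eq_of_lt (by omega)]; exact h1.symm
      · right; refine ⟨?_, by rw [h1]; exact h3⟩; rw [h2, Nat.mod_self]; exact h1.symm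
    · rcases hI j i h hi u huj hui with ⟨h1, h2⟩ | ⟨h1, h2, h3⟩
      · right; refine ⟨?_, h2⟩; rw [Nat.mod_eq_of_lt (by omega)]; exact h1.symm
      · left; refine ⟨?_, by rw [h1]; exact h3⟩; rw [h2, Nat.mod_self]; exact h1.symm
  refine ⟨hn, fun i => e i, ?_, fun i => hE i i.2, ?_, ?_, ?_⟩
  · intro i j hij
    by_contra hne
    have hne' : (i : ℕ) ≠ j := fun h => hne (Fin.ext h)
    have hij' : e i = e j := hij
    have h1 := hsub i i.2 j j.2 hne' _ (hl i i.2) (hij' ▸ hl i i.2)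
    have h2 := hsub i i.2 j j.2 hne' _ (hij' ▸ hl j j.2) (hl j j.2)
    have a1 := nx i i.2
    have a2 := nx j j.2
    rcases h1 with ⟨h1, h3⟩ | ⟨h1, h3⟩
    · exact hne' (hV' _ i.2 _ j.2 h3)
    · rcases h2 with ⟨h2, h4⟩ | ⟨h2, h4⟩
      -- Each index would be the cyclic successor of the other, impossible for `3 ≤ n`.
      · omega
      · exact hne' (hV' _ j.2 _ i.2 h4).symm
  -- Removing from each edge the vertex shared with its successor keeps the union, since the
  -- successor still has it, and makes the edges disjoint: `n` sets of size `r - 1`.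
  · have hU : (Finset.univ.biUnion fun i : Fin n => e i) =
        Finset.univ.biUnion fun i : Fin n => (e i).erase (v ((i + 1) % n)) := by
      ext u
      simp only [Finset.mem_biUnion, Finset.mem_univ, true_and, Finset.mem_erase]
      constructor
      · rintro ⟨i, hi⟩
        by_cases hu : u = v ((i + 1) % n)
        · have hlt : (i + 1 : ℕ) % n < n := Nat.mod_lt _ (by omega)
          refine ⟨⟨(i + 1) % n, hlt⟩, ?_, hu ▸ hl _ hlt⟩
          intro h
          have := hV' _ hlt _ (Nat.mod_lt _ (by omega)) (hu.symm.trans h)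
          have a1 := nx _ hlt
          dsimp only at this
          omega
        · exact ⟨i, hu, hi⟩
      · rintro ⟨i, -, hi⟩
        exact ⟨i, hi⟩
    rw [hU, Finset.card_biUnion]
    · rw [Finset.sum_congr rfl (g := fun _ => r - 1)]
      · simp [mul_comm]
      · intro i _
        rw [Finset.card_erase_of_mem (hrt i i.2), hr _ (hE i i.2)]
    · intro i _ j _ hij
      refine Finset.disjoint_left.2 fun u hui huj => ?_
      rw [Finset.mem_erase] at hui huj
      rcases hsub i i.2 j j.2 (fun h => hij (Fin.ext h)) u hui.2 huj.2 with ⟨h1, h2⟩ | ⟨h1, h2⟩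
      · exact hui.1 (by rw [h1]; exact h2)
      · exact huj.1 (by rw [h1]; exact h2)
  · intro i j hij
    have hne : (i : ℕ) ≠ j := by have := nx i i.2; omega
    rw [Finset.card_eq_one]
    refine ⟨v j, ?_⟩
    ext u
    rw [Finset.mem_inter, Finset.mem_singleton]
    constructor
    · rintro ⟨h1, h2⟩
      rcases hsub i i.2 j j.2 hne u h1 h2 with ⟨_, h4⟩ | ⟨h3, h4⟩
      · exact h4
      · have a1 := nx i i.2
        have a2 := nx j j.2
        omega
    · rintro rfl
      exact ⟨by have := hrt i i.2; rwa [hij] at this, hl j j.2⟩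
  · intro i j hij h1 h2
    rw [Finset.disjoint_left]
    intro u hui huj
    rcases hsub i i.2 j j.2 (fun h => hij (Fin.ext h)) u hui huj with ⟨h, _⟩ | ⟨h, _⟩
    · exact h1 h
    · exact h2 h

theorem PathBetween.hasLinearCycle [DecidableEq α] {r : ℕ} (hr : ∀ f ∈ E, f.card = r) {a b : α}
    {m m' : ℕ} {U U' : Set α} (h : PathBetween E a b m U) (h' : PathBetween E b a m' U')
    (hm : 2 ≤ m) (hm' : 2 ≤ m') (hU : ∀ u ∈ U, u ∈ U' → u = a ∨ u = b) :
    HasLinearCycle E r (m + m') := by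
  obtain ⟨e, v, h, rfl, rfl, hUe⟩ := h
  obtain ⟨e', v', h', h0, h1, hUe'⟩ := h'
  -- Each junction vertex lies only in the end edge of either path, so the two paths meet only in
  -- cyclically consecutive edges.
  have hx : ∀ i < m, v 0 ∈ e i → i = 0 := by
    intro i hi h2
    by_contra hi0
    have := h.inter 0 i (by omega) hi _ (h.left 0 (by omega)) h2
    exact h.inj 0 i (by omega) hi.le this.2
  have hy : ∀ i < m, v m ∈ e i → i + 1 = m := by
    intro i hi h2
    by_contra hi0
    have h3 := h.right (m - 1) (by omega)
    rw [Nat.sub_add_cancel (by omega)] at h3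
    have := h.inter i (m - 1) (by omega) (by omega) _ h2 h3
    exact h.inj (m - 1) m (by omega) le_rfl this.2.symm
  have hx' : ∀ i < m', v m ∈ e' i → i = 0 := by
    intro i hi h2
    by_contra hi0
    have := h'.inter 0 i (by omega) hi _ (h'.left 0 (by omega)) (h0 ▸ h2)
    exact h'.inj 0 i (by omega) hi.le this.2
  have hy' : ∀ i < m', v 0 ∈ e' i → i + 1 = m' := by
    intro i hi h2
    by_contra hi0
    have h3 := h'.right (m' - 1) (by omega)
    rw [Nat.sub_add_cancel (by omega)] at h3
    have := h'.inter i (m' - 1) (by omega) (by omega) _ (h1 ▸ h2) h3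
    exact h'.inj (m' - 1) m' (by omega) le_rfl this.2.symm
  refine hasLinearCycle_of_cyclic hr (by omega) (fun i => if i < m then e i else e' (i - m))
    (fun i => if i < m then v i else v' (i - m)) ?_ ?_ ?_ ?_ ?_
  · intro i hi
    by_cases him : i < m
    · simpa [him] using h.mem i him
    · simpa [him] using h'.mem (i - m) (by omega)
  · intro i hi
    by_cases him : i < m
    · simpa [him] using h.left i him
    · simpa [him] using h'.left (i - m) (by omega)
  · intro i hi
    by_cases him : i < m
    · rw [Nat.mod_eq_of_lt (by omega)]
      have := h.right i him
      by_cases him' : i + 1 < m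
      · simpa [him, him'] using this
      · have h3 : i + 1 = m := by omega
        rw [h3] at this
        simpa [him, h3, h0] using this
    · have := h'.right (i - m) (by omega)
      by_cases hi2 : i + 1 < m + m'
      · rw [Nat.mod_eq_of_lt hi2]
        rw [show i - m + 1 = i + 1 - m by omega] at this
        simpa [him, show ¬ (i + 1 < m) by omega] using this
      · have h3 : i + 1 = m + m' := by omega
        rw [h3, Nat.mod_self]
        rw [show i - m + 1 = m' by omega, h1] at this
        simpa [him, show 0 < m by omega] using this
  · intro i j hij hj u hui huj
    by_cases hjm : j < m
    · have him : i < m := by omega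
      simp only [him, hjm, if_true] at hui huj ⊢
      exact Or.inl (h.inter i j hij hjm u hui huj)
    · simp only [hjm, if_false] at huj ⊢
      by_cases him : i < m
      · simp only [him, if_true] at hui
        rcases hU u ((hUe u).2 ⟨i, him, hui⟩) ((hUe' u).2 ⟨j - m, by omega, huj⟩) with rfl | rfl
        · have := hx i him hui
          have := hy' _ (by omega) huj
          exact Or.inr ⟨by omega, by omega, by simp [show 0 < m by omega]⟩
        · have := hy i him hui
          have h3 := hx' _ (by omega) huj
          exact Or.inl ⟨by omega, by rw [h3, h0]⟩
      · simp only [him, if_false] at hui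
        have := h'.inter (i - m) (j - m) (by omega) (by omega) u hui huj
        exact Or.inl ⟨by omega, this.2⟩
  · intro i j hij hj
    by_cases hjm : j < m
    · have him : i < m := by omega
      simpa [him, hjm] using h.inj i j hij hjm.le
    · by_cases him : i < m
      · simp only [him, hjm, if_true, if_false]
        intro h3
        have h4 := h.left i him
        have h5 := h'.left (j - m) (by omega)
        rcases hU _ ((hUe _).2 ⟨i, him, h4⟩)
          ((hUe' _).2 ⟨j - m, by omega, h3 ▸ h5⟩) with h6 | h6
        · exact h'.inj (j - m) m' (by omega) le_rfl (by rw [h1, ← h6, h3])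
        · exact h.inj i m him le_rfl h6
      · simpa [him, hjm] using h'.inj (i - m) (j - m) (by omega) (by omega)

end LinearCycles

namespace LinearCycles

/-! ### Cores of large minimum degree and the crossing lemma -/

section Peeling

variable {α β : Type*}

/-- Each forbidden vertex excludes at most one member of `D` for each kind of conflict. This is the
greedy choice behind all path extensions. -/
theorem exists_avoiding {D : Finset β} {B₁ B₂ : Finset α} (R₁ R₂ : β → α → Prop)
    (h₁ : ∀ u ∈ B₁, ∀ e ∈ D, ∀ g ∈ D, R₁ e u → R₁ g u → e = g)
    (h₂ : ∀ u ∈ B₂, ∀ e ∈ D, ∀ g ∈ D, R₂ e u → R₂ g u → e = g)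
    (hD : B₁.card + B₂.card < D.card) :
    ∃ e ∈ D, (∀ u ∈ B₁, ¬ R₁ e u) ∧ ∀ u ∈ B₂, ¬ R₂ e u := by
  classical
  by_contra hno
  have hb : ∀ (B : Finset α) (R : β → α → Prop),
      (∀ u ∈ B, ∀ e ∈ D, ∀ g ∈ D, R e u → R g u → e = g) →
      (D.filter fun e => ∃ u ∈ B, R e u).card ≤ B.card := by
    intro B R h
    refine Finset.card_le_card_of_forall_subsingleton R
      (fun e he => (Finset.mem_filter.1 he).2) fun u hu e he g hg => ?_
    exact h u hu e (Finset.mem_filter.1 he.1).1 g (Finset.mem_filter.1 hg.1).1 he.2 hg.2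
  have hsub : D ⊆ (D.filter fun e => ∃ u ∈ B₁, R₁ e u) ∪ D.filter fun e => ∃ u ∈ B₂, R₂ e u := by
    intro e he
    rw [Finset.mem_union, Finset.mem_filter, Finset.mem_filter]
    by_contra h
    push Not at h
    exact hno ⟨e, he, h.1 he, h.2 he⟩
  have h3 := (Finset.card_le_card hsub).trans (Finset.card_union_le _ _)
  have h4 := hb B₁ R₁ h₁
  have h5 := hb B₂ R₂ h₂
  omega

variable [DecidableEq α]

theorem exists_peel {F : Finset β} (x y : β → α) {c : ℕ} {e : β} (he : e ∈ F)
    (hc : (F.filter fun g => x g = x e).card < c) :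
    ∃ F₁ ⊂ F, F.card + c * ((F₁.image x).card + (F₁.image y).card) ≤
      F₁.card + c * ((F.image x).card + (F.image y).card) := by
  refine ⟨F.filter fun g => ¬ x g = x e, ?_, ?_⟩
  · exact Finset.filter_ssubset.2 ⟨e, he, by simp⟩
  · have h1 := Finset.card_filter_add_card_filter_not (s := F) (fun g => x g = x e)
    have h2 : ((F.filter fun g => ¬ x g = x e).image x).card + 1 ≤ (F.image x).card := by
      rw [Nat.succ_le_iff]
      refine Finset.card_lt_card (Finset.ssubset_iff_of_subset
        (Finset.image_subset_image (Finset.filter_subset _ _)) |>.2 ⟨x e, ?_, ?_⟩)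
      · exact Finset.mem_image_of_mem _ he
      · simp
    have h3 : ((F.filter fun g => ¬ x g = x e).image y).card ≤ (F.image y).card :=
      Finset.card_le_card (Finset.image_subset_image (Finset.filter_subset _ _))
    have h4 := Nat.mul_le_mul_left c (Nat.add_le_add h2 h3)
    simp only [Nat.mul_add, Nat.mul_one] at h4 ⊢
    omega

/-- Deleting an endpoint of degree below `c` loses fewer than `c` edges, so the number of edges
minus `c` times the number of endpoints never drops. The core may be empty. -/
theorem exists_core (F : Finset β) (x y : β → α) (c : ℕ) :
    ∃ F' ⊆ F, (∀ e ∈ F', c ≤ (F'.filter fun g => x g = x e).card) ∧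
      (∀ e ∈ F', c ≤ (F'.filter fun g => y g = y e).card) ∧
      F.card + c * ((F'.image x).card + (F'.image y).card) ≤
        F'.card + c * ((F.image x).card + (F.image y).card) := by
  induction F using Finset.strongInduction with
  | H F ih =>
    have key : ∀ F₁ ⊂ F, F.card + c * ((F₁.image x).card + (F₁.image y).card) ≤
        F₁.card + c * ((F.image x).card + (F.image y).card) →
        ∃ F' ⊆ F, (∀ e ∈ F', c ≤ (F'.filter fun g => x g = x e).card) ∧
        (∀ e ∈ F', c ≤ (F'.filter fun g => y g = y e).card) ∧
        F.card + c * ((F'.image x).card + (F'.image y).card) ≤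
          F'.card + c * ((F.image x).card + (F.image y).card) := by
      intro F₁ hF₁ h
      obtain ⟨F', h1, h2, h3, h4⟩ := ih F₁ hF₁
      exact ⟨F', h1.trans hF₁.1, h2, h3, by omega⟩
    by_cases hx : ∃ e ∈ F, (F.filter fun g => x g = x e).card < c
    · obtain ⟨e, he, hc⟩ := hx
      obtain ⟨F₁, h1, h2⟩ := exists_peel x y he hc
      exact key F₁ h1 h2
    by_cases hy : ∃ e ∈ F, (F.filter fun g => y g = y e).card < c
    · obtain ⟨e, he, hc⟩ := hy
      obtain ⟨F₁, h1, h2⟩ := exists_peel y x he hc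
      exact key F₁ h1 (by rwa [add_comm (F₁.image x).card, add_comm (F.image x).card])
    push Not at hx hy
    exact ⟨F, subset_rfl, hx, hy, le_rfl⟩

/-- A dense bipartite family of edges has a subfamily such that every nontrivial two-colouring of
its first endpoints admits a monochromatic core touched by an edge of the other colour. -/
theorem exists_crossing (F : Finset β) (x y : β → α) {c : ℕ} (hc : 1 ≤ c)
    (hinj : ∀ e ∈ F, ∀ g ∈ F, x e = x g → y e = y g → e = g)
    (hF : c * (F.image x).card + 2 * c * (F.image y).card < F.card) :
    ∃ F₀ ⊆ F, 2 ≤ (F₀.image x).card ∧ ∀ χ : α → Prop, (∃ a ∈ F₀.image x, χ a) →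
      (∃ b ∈ F₀.image x, ¬ χ b) → ∃ F' ⊆ F₀,
        (∀ e ∈ F', c ≤ (F'.filter fun g => x g = x e).card) ∧
        (∀ e ∈ F', c ≤ (F'.filter fun g => y g = y e).card) ∧
        ∃ e₀ ∈ F₀, ∃ e' ∈ F', y e₀ = y e' ∧ ∀ g ∈ F', (χ (x g) ↔ ¬ χ (x e₀)) := by
  classical
  induction F using Finset.strongInduction with
  | H F ih =>
    -- `F₀` is a minimal subfamily satisfying the density inequality, so every proper subfamily
    -- violates it.
    by_cases hmin : ∃ F₁ ⊂ F, c * (F₁.image x).card + 2 * c * (F₁.image y).card < F₁.card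
    · obtain ⟨F₁, h1, h2⟩ := hmin
      obtain ⟨F₀, h3, h4⟩ := ih F₁ h1
        (fun e he g hg => hinj e (h1.1 he) g (h1.1 hg)) h2
      exact ⟨F₀, h3.trans h1.1, h4⟩
    push Not at hmin
    refine ⟨F, subset_rfl, ?_, ?_⟩
    -- With a single first endpoint, `y` is injective on `F`, and the density inequality would read
    -- `2c|F| < |F|` or worse.
    · by_contra hlt
      have h1 : (F.image x).card ≤ 1 := by omega
      have h2 : (F.image y).card = F.card := by
        refine Finset.card_image_of_injOn fun e he g hg h => hinj e he g hg ?_ h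
        exact Finset.card_le_one.1 h1 _ (Finset.mem_image_of_mem _ he) _
          (Finset.mem_image_of_mem _ hg)
      rw [h2] at hF
      nlinarith
    · intro χ hχ hχ'
      by_contra hno
      obtain ⟨F₁, hF₁, hx₁, hy₁, hc₁⟩ := exists_core (F.filter fun g => χ (x g)) x y c
      obtain ⟨F₂, hF₂, hx₂, hy₂, hc₂⟩ := exists_core (F.filter fun g => ¬ χ (x g)) x y c
      have hs₁ : (F.filter fun g => χ (x g)) ⊂ F := by
        obtain ⟨b, hb, hb'⟩ := hχ'
        obtain ⟨e, he, rfl⟩ := Finset.mem_image.1 hb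
        exact Finset.filter_ssubset.2 ⟨e, he, hb'⟩
      have hs₂ : (F.filter fun g => ¬ χ (x g)) ⊂ F := by
        obtain ⟨b, hb, hb'⟩ := hχ
        obtain ⟨e, he, rfl⟩ := Finset.mem_image.1 hb
        exact Finset.filter_ssubset.2 ⟨e, he, by simpa using hb'⟩
      have hm₁ := hmin F₁ (hF₁.trans_ssubset hs₁)
      have hm₂ := hmin F₂ (hF₂.trans_ssubset hs₂)
      -- Without a crossing edge, the core of one class shares no second endpoint with the edges of
      -- the other class.
      have hd₁ : Disjoint (F₁.image y) ((F.filter fun g => ¬ χ (x g)).image y) := by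
        rw [Finset.disjoint_left]
        intro u hu hu'
        obtain ⟨e', he', rfl⟩ := Finset.mem_image.1 hu
        obtain ⟨e₀, he₀, h⟩ := Finset.mem_image.1 hu'
        rw [Finset.mem_filter] at he₀
        refine hno ⟨F₁, hF₁.trans hs₁.1, hx₁, hy₁, e₀, he₀.1, e', he', h, fun g hg => ?_⟩
        exact iff_of_true (Finset.mem_filter.1 (hF₁ hg)).2 he₀.2
      have hd₂ : Disjoint (F₂.image y) ((F.filter fun g => χ (x g)).image y) := by
        rw [Finset.disjoint_left]
        intro u hu hu'
        obtain ⟨e', he', rfl⟩ := Finset.mem_image.1 hu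
        obtain ⟨e₀, he₀, h⟩ := Finset.mem_image.1 hu'
        rw [Finset.mem_filter] at he₀
        refine hno ⟨F₂, hF₂.trans hs₂.1, hx₂, hy₂, e₀, he₀.1, e', he', h, fun g hg => ?_⟩
        exact iff_of_false (Finset.mem_filter.1 (hF₂ hg)).2 (not_not.2 he₀.2)
      have hd₃ : Disjoint ((F.filter fun g => χ (x g)).image x)
          ((F.filter fun g => ¬ χ (x g)).image x) := by
        rw [Finset.disjoint_left]
        intro u hu hu'
        obtain ⟨e', he', rfl⟩ := Finset.mem_image.1 hu
        obtain ⟨e₀, he₀, h⟩ := Finset.mem_image.1 hu'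
        rw [Finset.mem_filter] at he₀ he'
        exact he₀.2 (h ▸ he'.2)
      have hu : ∀ (z : β → α) (A B : Finset β), A ⊆ F → B ⊆ F →
          Disjoint (A.image z) (B.image z) →
          c * (A.image z).card + c * (B.image z).card ≤ c * (F.image z).card := by
        intro z A B hA hB h
        rw [← Nat.mul_add, ← Finset.card_union_of_disjoint h]
        exact Nat.mul_le_mul_left c (Finset.card_le_card (Finset.union_subset
          (Finset.image_subset_image hA) (Finset.image_subset_image hB)))
      have i₁ := hu y _ _ (hF₁.trans hs₁.1) hs₂.1 hd₁
      have i₂ := hu y _ _ (hF₂.trans hs₂.1) hs₁.1 hd₂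
      have i₃ := hu x _ _ hs₁.1 hs₂.1 hd₃
      have i₄ := Finset.card_filter_add_card_filter_not (s := F) (fun g => χ (x g))
      -- The core inequality and minimality bound each class by `c` times (its first endpoints, its
      -- second endpoints and those of its core). By disjointness the sum is at most `c|x(F)| +
      -- 2c|y(F)|`, contradicting density.
      simp only [Nat.mul_add, Nat.mul_assoc] at hc₁ hc₂ hm₁ hm₂ hF
      omega

end Peeling

/-! ### Greedy alternating paths closed through hanging edges -/

variable {α : Type*} {E : Finset (Finset α)}

/-- Every vertex `x` of `X` hangs by an edge `f x` on the set `S`, these edges are disjoint outside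
`S`, and `X` splits into two nonempty parts such that vertices in different parts are joined by
linear paths of a common even length `2 * ℓ ≤ 2 * t` inside `S` and the two hanging edges. -/
def Splits (E : Finset (Finset α)) (S M X : Finset α) (t : ℕ) : Prop :=
  ∃ f : α → Finset α,
    (∀ x ∈ X, f x ∈ E ∧ x ∈ f x ∧ (∃ u ∈ f x, u ∈ S) ∧ ∀ u ∈ f x, u ∈ S ∨ u ∈ M) ∧
    (∀ x ∈ X, ∀ y ∈ X, x ≠ y → ∀ u ∈ f x, u ∈ f y → u ∈ S) ∧
    ∃ (ℓ : ℕ) (χ : α → Prop), 1 ≤ ℓ ∧ ℓ ≤ t ∧ (∃ a ∈ X, χ a) ∧ (∃ b ∈ X, ¬ χ b) ∧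
      ∀ a ∈ X, ∀ b ∈ X, χ a → ¬ χ b →
        ∃ U : Set α, PathBetween E a b (2 * ℓ) U ∧ ∀ u ∈ U, u ∈ S ∨ u ∈ f a ∨ u ∈ f b

section Greedy

variable [DecidableEq α] {k r : ℕ} {F' : Finset (Finset α)} {S : Finset α} {a : α}

/-- The last edge back to an `x`-end must avoid the path and `f a`, and its hanging edge `f (x e)`
must avoid the path. By linearity a vertex spoils at most one edge through `y g`. Outside `S` it
lies on at most one hanging edge, so it spoils at most one choice in that way too. -/
theorem exists_even_path (hr : ∀ e ∈ E, e.card = r) (hr0 : 0 < r)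
    (hlin : ∀ e ∈ E, ∀ g ∈ E, ∀ u v, u ∈ e → u ∈ g → v ∈ e → v ∈ g → u ≠ v → e = g)
    {x y : Finset α → α} {f : α → Finset α} (hF : F' ⊆ E)
    (hx : ∀ e ∈ F', x e ∈ e) (hy : ∀ e ∈ F', y e ∈ e) (hxy : ∀ e ∈ F', x e ≠ y e)
    (hS : ∀ e ∈ F', ∀ u ∈ e, u ∉ S)
    (hfE : ∀ e ∈ F', f (x e) ∈ E ∧ x e ∈ f (x e) ∧ ∃ u ∈ f (x e), u ∈ S)
    (hfd : ∀ e ∈ F', ∀ g ∈ F', x e ≠ x g → ∀ u ∈ f (x e), u ∈ f (x g) → u ∈ S)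
    (hfa : f a ∈ E)
    (hdy : ∀ e ∈ F', 4 * k * r ≤ (F'.filter fun g => y g = y e).card)
    {i : ℕ} (hik : i ≤ k) (hi : 1 ≤ i) {g : Finset α} (hg : g ∈ F') {U : Finset α}
    (hP : PathBetween E a (y g) (2 * i - 1) U) (hU : U.card ≤ r * (2 * i - 1))
    (hUS : ∀ u ∈ U, u ∉ S) (hUa : ∀ u ∈ U, u ∈ f a → u = a) :
    ∃ e ∈ F', PathBetween E a (x e) (2 * i) ((U ∪ e : Finset α) : Set α) ∧
      (∀ u ∈ U ∪ e, u ∈ f a → u = a) ∧ ∀ u ∈ U ∪ e, u ∈ f (x e) → u = x e := by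
  have hbU : y g ∈ U := hP.right_mem (by omega)
  obtain ⟨e, he, h1, h2⟩ := exists_avoiding (D := F'.filter fun e => y e = y g)
    (B₁ := U ∪ f a) (B₂ := U) (fun e u => u ∈ e ∧ u ≠ y g) (fun e u => u ∈ f (x e))
    (by
      intro u _ e he e' he' h h'
      rw [Finset.mem_filter] at he he'
      exact hlin e (hF he.1) e' (hF he'.1) u (y g) h.1 h'.1 (he.2 ▸ hy e he.1)
        (he'.2 ▸ hy e' he'.1) h.2)
    (by
      intro u hu e he e' he' h h'
      rw [Finset.mem_filter] at he he'
      have hxx : x e = x e' := by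
        by_contra hne
        exact hUS u hu (hfd e he.1 e' he'.1 hne u h h')
      exact hlin e (hF he.1) e' (hF he'.1) (x e) (y g) (hx e he.1) (hxx ▸ hx e' he'.1)
        (he.2 ▸ hy e he.1) (he'.2 ▸ hy e' he'.1) (he.2 ▸ hxy e he.1))
    (by
      -- At most `2|U| + r ≤ 2r(2i - 1) + r < 4kr` edges are excluded.
      have h1 := hdy g hg
      have h2 := Finset.card_union_le U (f a)
      have h3 := hr _ hfa
      obtain ⟨j, rfl⟩ := Nat.exists_eq_add_of_le hik
      obtain ⟨i, rfl⟩ := Nat.exists_eq_add_of_le hi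
      rw [show 2 * (1 + i) - 1 = 2 * i + 1 by omega] at hU
      nlinarith [Nat.zero_le (j * r), Nat.zero_le (i * r)])
  rw [Finset.mem_filter] at he
  obtain ⟨he, hye⟩ := he
  have hU1 : ∀ u ∈ e, u ∈ U → u = y g := by
    intro u hu hu'
    by_contra hne
    exact h1 u (Finset.mem_union_left _ hu') ⟨hu, hne⟩
  refine ⟨e, he, ?_, ?_, ?_⟩
  · have := hP.snoc (hF he) (hye ▸ hy e he) (hx e he) (hye ▸ hxy e he) hU1
    rwa [show 2 * i - 1 + 1 = 2 * i by omega, ← Finset.coe_union] at this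
  · intro u hu hua
    rcases Finset.mem_union.1 hu with hu | hu
    · exact hUa u hu hua
    · have h3 : u = y g := by
        by_contra hne
        exact h1 u (Finset.mem_union_right _ hua) ⟨hu, hne⟩
      exact hUa u (h3 ▸ hbU) hua
  · intro u hu hue
    rcases Finset.mem_union.1 hu with hu | hu
    · exact absurd hue (h2 u hu)
    · by_contra hne
      -- A second common vertex would make `e` equal to its hanging edge, but only the latter meets
      -- `S`.
      obtain ⟨hf1, hf2, w, hw, hwS⟩ := hfE e he
      have h3 := hlin e (hF he) _ hf1 u (x e) hu hue (hx e he) hf2 hne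
      exact hS e he w (h3 ▸ hw) hwS

/-- The path begins with the crossing edge `e₀` and then alternates inside the core. Only the start
`a` may meet `f a`, so that the tree path can later return through `f a`. -/
theorem exists_odd_path (hr : ∀ e ∈ E, e.card = r) (hr0 : 0 < r)
    (hlin : ∀ e ∈ E, ∀ g ∈ E, ∀ u v, u ∈ e → u ∈ g → v ∈ e → v ∈ g → u ≠ v → e = g)
    {x y : Finset α → α} {f : α → Finset α} (hF : F' ⊆ E)
    (hx : ∀ e ∈ F', x e ∈ e) (hy : ∀ e ∈ F', y e ∈ e) (hxy : ∀ e ∈ F', x e ≠ y e)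
    (hS : ∀ e ∈ F', ∀ u ∈ e, u ∉ S)
    (hfE : ∀ e ∈ F', f (x e) ∈ E ∧ x e ∈ f (x e) ∧ ∃ u ∈ f (x e), u ∈ S)
    (hfd : ∀ e ∈ F', ∀ g ∈ F', x e ≠ x g → ∀ u ∈ f (x e), u ∈ f (x g) → u ∈ S)
    (hfa : f a ∈ E) (haf : a ∈ f a) (hfaS : ∃ u ∈ f a, u ∈ S)
    (hdx : ∀ e ∈ F', 4 * k * r ≤ (F'.filter fun g => x g = x e).card)
    (hdy : ∀ e ∈ F', 4 * k * r ≤ (F'.filter fun g => y g = y e).card)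
    {e₀ g₀ : Finset α} (he₀ : e₀ ∈ E) (hae : a ∈ e₀) (hg₀ : g₀ ∈ F') (hye : y g₀ ∈ e₀)
    (hay : a ≠ y g₀) (he₀S : ∀ u ∈ e₀, u ∉ S) (i : ℕ) (hi : 1 ≤ i) (hik : i ≤ k) :
    ∃ g ∈ F', ∃ U : Finset α, PathBetween E a (y g) (2 * i - 1) U ∧
      U.card ≤ r * (2 * i - 1) ∧ (∀ u ∈ U, u ∉ S) ∧ ∀ u ∈ U, u ∈ f a → u = a := by
  induction i, hi using Nat.le_induction with
  | base =>
    refine ⟨g₀, hg₀, e₀, ?_, ?_, he₀S, ?_⟩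
    · have := (PathBetween.nil (E := E) a).snoc he₀ hae hye hay.symm (by simp)
      simpa using this
    · simp [hr e₀ he₀]
    · intro u hu hua
      by_contra hne
      obtain ⟨w, hw, hwS⟩ := hfaS
      have h3 := hlin e₀ he₀ _ hfa u a hu hua hae haf hne
      exact he₀S w (h3 ▸ hw) hwS
  | succ i hi ih =>
    obtain ⟨g, hg, U, hP, hU, hUS, hUa⟩ := ih (by omega)
    obtain ⟨e, he, hPe, hea, -⟩ := exists_even_path hr hr0 hlin hF hx hy hxy hS hfE hfd hfa hdy
      (by omega : i ≤ k) hi hg hP hU hUS hUa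
    have hcard : (U ∪ e).card ≤ r * (2 * i) := by
      have h1 := Finset.card_union_le U e
      rw [hr e (hF he)] at h1
      obtain ⟨i, rfl⟩ := Nat.exists_eq_add_of_le hi
      rw [show 2 * (1 + i) - 1 = 2 * i + 1 by omega] at hU
      nlinarith
    have hxU : x e ∈ U ∪ e := Finset.mem_union_right _ (hx e he)
    obtain ⟨e', he', h1, -⟩ := exists_avoiding (D := F'.filter fun e' => x e' = x e)
      (B₁ := (U ∪ e) ∪ f a) (B₂ := ∅) (fun e' u => u ∈ e' ∧ u ≠ x e) (fun _ _ => False)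
      (by
        intro u _ e₁ he₁ e₂ he₂ h h'
        rw [Finset.mem_filter] at he₁ he₂
        exact hlin e₁ (hF he₁.1) e₂ (hF he₂.1) u (x e) h.1 h'.1 (he₁.2 ▸ hx _ he₁.1)
          (he₂.2 ▸ hx _ he₂.1) h.2)
      (by simp)
      (by
        -- At most `|U ∪ e| + r ≤ 2ir + r < 4kr` edges are excluded.
        have h1 := hdx e he
        have h2 := Finset.card_union_le (U ∪ e) (f a)
        have h3 := hr _ hfa
        obtain ⟨j, rfl⟩ := Nat.exists_eq_add_of_le hik
        simp only [Finset.card_empty]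
        nlinarith [Nat.zero_le (j * r), Nat.zero_le (i * r)])
    rw [Finset.mem_filter] at he'
    obtain ⟨he', hxe⟩ := he'
    have hU1 : ∀ u ∈ e', u ∈ U ∪ e → u = x e := by
      intro u hu hu'
      by_contra hne
      exact h1 u (Finset.mem_union_left _ hu') ⟨hu, hne⟩
    refine ⟨e', he', (U ∪ e) ∪ e', ?_, ?_, ?_, ?_⟩
    · have := hPe.snoc (hF he') (hxe ▸ hx e' he') (hy e' he') (hxe ▸ (hxy e' he').symm) hU1
      rwa [← Finset.coe_union] at this
    · have h2 := Finset.card_union_le (U ∪ e) e'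
      rw [hr e' (hF he')] at h2
      rw [show 2 * (i + 1) - 1 = 2 * i + 1 by omega]
      nlinarith
    · intro u hu
      rcases Finset.mem_union.1 hu with hu | hu
      · rcases Finset.mem_union.1 hu with hu | hu
        · exact hUS u hu
        · exact hS e he u hu
      · exact hS e' he' u hu
    · intro u hu hua
      rcases Finset.mem_union.1 hu with hu | hu
      · exact hea u hu hua
      · have h3 : u = x e := by
          by_contra hne
          exact h1 u (Finset.mem_union_right _ hua) ⟨hu, hne⟩
        exact hea u (h3 ▸ hxU) hua

theorem exists_linear_cycles (hk : 1 ≤ k) (hr : ∀ e ∈ E, e.card = r) (hr0 : 0 < r)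
    (hlin : ∀ e ∈ E, ∀ g ∈ E, ∀ u v, u ∈ e → u ∈ g → v ∈ e → v ∈ g → u ≠ v → e = g)
    {F : Finset (Finset α)} {x y : Finset α → α} {M : Finset α} {t : ℕ} (hF : F ⊆ E)
    (hx : ∀ e ∈ F, x e ∈ e) (hy : ∀ e ∈ F, y e ∈ e) (hxy : ∀ e ∈ F, x e ≠ y e)
    (hS : ∀ e ∈ F, ∀ u ∈ e, u ∉ S)
    (hsplit : ∀ X ⊆ F.image x, 2 ≤ X.card → Splits E S M X t)
    (hcard : 4 * k * r * (F.image x).card + 2 * (4 * k * r) * (F.image y).card < F.card) :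
    ∃ ℓ, 1 ≤ ℓ ∧ ℓ ≤ t ∧ ∀ i, 1 ≤ i → i ≤ k → HasLinearCycle E r (2 * ℓ + 2 * i) := by
  obtain ⟨F₀, hF₀, h2, hχ⟩ := exists_crossing F x y (c := 4 * k * r)
    (Nat.mul_pos (by omega) hr0)
    (fun e he g hg h h' => hlin e (hF he) g (hF hg) (x e) (y e) (hx e he) (h ▸ hx g hg)
      (hy e he) (h' ▸ hy g hg) (hxy e he)) hcard
  obtain ⟨f, hf, hfd, ℓ, χ, hℓ, hℓt, ha, hb, hpath⟩ :=
    hsplit _ (Finset.image_subset_image hF₀) h2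
  obtain ⟨F', hF', hdx, hdy, e₀, he₀, g₀, hg₀, hyy, hsep⟩ := hχ χ ha hb
  refine ⟨ℓ, hℓ, hℓt, fun i hi hik => ?_⟩
  have hF'' : F' ⊆ F := hF'.trans hF₀
  have hfE : ∀ e ∈ F₀, f (x e) ∈ E ∧ x e ∈ f (x e) ∧ ∃ u ∈ f (x e), u ∈ S := by
    intro e he
    obtain ⟨h1, h2, h3, -⟩ := hf _ (Finset.mem_image_of_mem _ he)
    exact ⟨h1, h2, h3⟩
  have hfd' : ∀ e ∈ F', ∀ g ∈ F', x e ≠ x g → ∀ u ∈ f (x e), u ∈ f (x g) → u ∈ S :=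
    fun e he g hg => hfd _ (Finset.mem_image_of_mem _ (hF' he)) _
      (Finset.mem_image_of_mem _ (hF' hg))
  obtain ⟨hfa, haf, hfaS⟩ := hfE e₀ he₀
  obtain ⟨g, hg, U, hP, hU, hUS, hUa⟩ := exists_odd_path hr hr0 hlin (hF''.trans hF)
    (fun e he => hx e (hF'' he)) (fun e he => hy e (hF'' he)) (fun e he => hxy e (hF'' he))
    (fun e he => hS e (hF'' he)) (fun e he => hfE e (hF' he)) hfd' hfa haf hfaS hdx hdy
    (hF (hF₀ he₀)) (hx _ (hF₀ he₀)) hg₀ (hyy ▸ hy _ (hF₀ he₀)) (hyy ▸ hxy _ (hF₀ he₀))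
    (hS _ (hF₀ he₀)) i hi hik
  obtain ⟨e, he, hPe, hea, hee⟩ := exists_even_path hr hr0 hlin (hF''.trans hF)
    (fun e he => hx e (hF'' he)) (fun e he => hy e (hF'' he)) (fun e he => hxy e (hF'' he))
    (fun e he => hS e (hF'' he)) (fun e he => hfE e (hF' he)) hfd' hfa hdy hik hi hg hP hU hUS hUa
  -- The end `x e` lies in the core, hence in the class opposite to `x e₀`; which of the two
  -- satisfies `χ` only decides the direction of the tree path.
  have hback : ∃ W : Set α, PathBetween E (x e) (x e₀) (2 * ℓ) W ∧
      ∀ u ∈ W, u ∈ S ∨ u ∈ f (x e) ∨ u ∈ f (x e₀) := by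
    have h1 := Finset.mem_image_of_mem x (hF' he)
    have h2 := Finset.mem_image_of_mem x he₀
    by_cases h : χ (x e)
    · exact hpath _ h1 _ h2 h ((hsep e he).1 h)
    · obtain ⟨W, hW, hW'⟩ := hpath _ h2 _ h1 (by have := hsep e he; tauto) h
      exact ⟨W, hW.symm, fun u hu => by have := hW' u hu; tauto⟩
  obtain ⟨W, hW, hW'⟩ := hback
  have hUeS : ∀ u ∈ U ∪ e, u ∉ S := by
    intro u hu
    rcases Finset.mem_union.1 hu with hu | hu
    · exact hUS u hu
    · exact hS e (hF'' he) u hu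
  have := hPe.hasLinearCycle hr hW (by omega) (by omega) (by
    intro u hu huW
    rcases hW' u huW with h | h | h
    · exact absurd h (hUeS u hu)
    · exact Or.inr (hee u hu h)
    · exact Or.inl (hea u hu h))
  rwa [add_comm] at this

end Greedy

end LinearCycles

/-! ### Edges leaving a level, and the next level of the tree -/

namespace LinearCycles

theorem exists_large_fiber {β γ : Type*} [Fintype γ] [Nonempty γ] [DecidableEq γ] (F : Finset β)
    (g : β → γ) : ∃ c, F.card ≤ Fintype.card γ * (F.filter fun e => g e = c).card := by
  by_contra! h
  obtain ⟨c₀⟩ := ‹Nonempty γ›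
  have h1 : F.card = ∑ c : γ, (F.filter fun e => g e = c).card :=
    Finset.card_eq_sum_card_fiberwise fun _ _ => Finset.mem_coe.2 (Finset.mem_univ _)
  have h2 : ∑ c : γ, Fintype.card γ * (F.filter fun e => g e = c).card < ∑ _c : γ, F.card :=
    Finset.sum_lt_sum_of_nonempty ⟨c₀, Finset.mem_univ _⟩ fun c _ => h c
  rw [← Finset.mul_sum, ← h1] at h2
  simp at h2

variable {α : Type*} [DecidableEq α] {E : Finset (Finset α)} {S M : Finset α} {k r t : ℕ}

/-- The edges that avoid `S` and meet `M` exactly once. -/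
def leaving (E : Finset (Finset α)) (S M : Finset α) : Finset (Finset α) :=
  E.filter fun e => (∀ u ∈ e, u ∉ S) ∧ (e ∩ M).card = 1

/-- The edges that meet `S` or meet `T` at least twice. -/
def crowded (E : Finset (Finset α)) (S T : Finset α) : Finset (Finset α) :=
  E.filter fun e => (∃ u ∈ e, u ∈ S) ∨ 2 ≤ (e ∩ T).card

/-- The vertices outside `T` covered by the edges in `W`. -/
def fresh (W : Finset (Finset α)) (T : Finset α) : Finset α :=
  W.biUnion fun f => f \ T

theorem mem_fresh {W : Finset (Finset α)} {T : Finset α} {u : α} :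
    u ∈ fresh W T ↔ ∃ f ∈ W, u ∈ f ∧ u ∉ T := by
  simp [fresh]

theorem leaving_inter_union {e : Finset α} (he : e ∈ leaving E S M) :
    (e ∩ (S ∪ M)).card = 1 := by
  obtain ⟨-, h1, h2⟩ := Finset.mem_filter.1 he
  rw [← h2]
  congr 1
  ext u
  simp only [Finset.mem_inter, Finset.mem_union]
  have := h1 u
  tauto

theorem leaving_eq {e : Finset α} (he : e ∈ leaving E S M) {u v : α} (hu : u ∈ e)
    (hu' : u ∈ S ∪ M) (hv : v ∈ e) (hv' : v ∈ S ∪ M) : u = v :=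
  Finset.card_le_one.1 (leaving_inter_union he).le _ (Finset.mem_inter.2 ⟨hu, hu'⟩) _
    (Finset.mem_inter.2 ⟨hv, hv'⟩)

theorem leaving_exists {e : Finset α} (he : e ∈ leaving E S M) : ∃ p ∈ e, p ∈ M := by
  obtain ⟨-, -, h2⟩ := Finset.mem_filter.1 he
  obtain ⟨p, hp⟩ := Finset.card_pos.1 (by omega : 0 < (e ∩ M).card)
  exact ⟨p, (Finset.mem_inter.1 hp).1, (Finset.mem_inter.1 hp).2⟩

/-- Double counting of incidences with `M`: an edge meeting `M` is leaving and counts once, or is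
crowded and counts at most `r` times. -/
theorem degree_sum_le (hr : ∀ e ∈ E, e.card = r) {δ : ℝ}
    (hδ : ∀ v ∈ M, δ ≤ ((E.filter fun e => v ∈ e).card : ℝ)) :
    δ * M.card ≤ (leaving E S M).card + r * (crowded E S (S ∪ M)).card := by
  have h1 : ∑ v ∈ M, (E.filter fun e => v ∈ e).card = ∑ e ∈ E, (e ∩ M).card := by
    simp only [Finset.card_filter]
    rw [Finset.sum_comm]
    refine Finset.sum_congr rfl fun e _ => ?_
    rw [← Finset.card_filter, Finset.inter_comm, Finset.filter_mem_eq_inter]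
  have h2 : ∑ e ∈ E, (e ∩ M).card ≤
      (leaving E S M).card + r * (crowded E S (S ∪ M)).card := by
    rw [leaving, crowded, Finset.card_filter, Finset.card_filter, Finset.mul_sum,
      ← Finset.sum_add_distrib]
    refine Finset.sum_le_sum fun e he => ?_
    have h3 : (e ∩ M).card ≤ r := hr e he ▸ Finset.card_le_card Finset.inter_subset_left
    by_cases hc : (∃ u ∈ e, u ∈ S) ∨ 2 ≤ (e ∩ (S ∪ M)).card
    · simp only [hc, if_true]
      omega
    · push Not at hc
      have h4 : (e ∩ M).card ≤ (e ∩ (S ∪ M)).card :=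
        Finset.card_le_card (Finset.inter_subset_inter_left Finset.subset_union_right)
      by_cases h5 : (e ∩ M).card = 1
      · have : (∀ u ∈ e, u ∉ S) ∧ (e ∩ M).card = 1 := ⟨hc.1, h5⟩
        rw [if_pos this]
        omega
      · omega
  have h3 : δ * M.card ≤ ∑ v ∈ M, ((E.filter fun e => v ∈ e).card : ℝ) := by
    rw [mul_comm, ← nsmul_eq_mul]
    exact Finset.card_nsmul_le_sum _ _ _ hδ
  rw [← Nat.cast_sum, h1] at h3
  exact h3.trans (by exact_mod_cast h2)

/-- `W` has maximum size among the families disjoint outside `S ∪ M`; a leaving edge missing its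
fresh vertices could be added. -/
theorem exists_maximal_disjoint (hr : ∀ e ∈ E, e.card = r) (hr2 : 2 ≤ r) :
    ∃ W ⊆ leaving E S M,
      (∀ f ∈ W, ∀ g ∈ W, f ≠ g → ∀ u ∈ f, u ∈ g → u ∈ S ∪ M) ∧
      ∀ e ∈ leaving E S M, ∃ u ∈ e, u ∈ fresh W (S ∪ M) := by
  classical
  obtain ⟨W, hW, hmax⟩ := Finset.exists_max_image
    ((leaving E S M).powerset.filter fun W =>
      ∀ f ∈ W, ∀ g ∈ W, f ≠ g → ∀ u ∈ f, u ∈ g → u ∈ S ∪ M) Finset.card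
    ⟨∅, by simp⟩
  rw [Finset.mem_filter, Finset.mem_powerset] at hW
  refine ⟨W, hW.1, hW.2, fun e he => ?_⟩
  by_contra! hno
  have hmeet : ∀ f ∈ W, ∀ u ∈ e, u ∈ f → u ∈ S ∪ M := by
    intro f hf u hu huf
    by_contra h
    exact hno u hu (mem_fresh.2 ⟨f, hf, huf, h⟩)
  have heW : e ∉ W := by
    intro h
    have h1 : e ⊆ e ∩ (S ∪ M) := fun u hu => Finset.mem_inter.2 ⟨hu, hmeet e h u hu hu⟩
    have h2 := Finset.card_le_card h1
    rw [leaving_inter_union he, hr e (Finset.mem_filter.1 he).1] at h2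
    omega
  have := hmax (insert e W) (by
    rw [Finset.mem_filter, Finset.mem_powerset]
    refine ⟨Finset.insert_subset he hW.1, ?_⟩
    intro f hf g hg hfg u hu hu'
    rcases Finset.mem_insert.1 hf with hfe | hfW
    · rcases Finset.mem_insert.1 hg with hge | hgW
      · exact absurd (hfe.trans hge.symm) hfg
      · exact hmeet g hgW u (hfe ▸ hu) hu'
    · rcases Finset.mem_insert.1 hg with hge | hgW
      · exact hmeet f hfW u (hge ▸ hu') hu
      · exact hW.2 f hfW g hgW hfg u hu hu')
  rw [Finset.card_insert_of_notMem heW] at this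
  omega

theorem card_fresh (hr : ∀ e ∈ E, e.card = r) {W : Finset (Finset α)} (hW : W ⊆ leaving E S M)
    (hd : ∀ f ∈ W, ∀ g ∈ W, f ≠ g → ∀ u ∈ f, u ∈ g → u ∈ S ∪ M) :
    (fresh W (S ∪ M)).card = (r - 1) * W.card := by
  rw [fresh, Finset.card_biUnion]
  · rw [Finset.sum_congr rfl (g := fun _ => r - 1)]
    · simp [mul_comm]
    · intro f hf
      have h1 := Finset.card_inter_add_card_sdiff f (S ∪ M)
      rw [leaving_inter_union (hW hf), hr f (Finset.mem_filter.1 (hW hf)).1] at h1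
      omega
  · intro f hf g hg hfg
    refine Finset.disjoint_left.2 fun u hu hu' => ?_
    rw [Finset.mem_sdiff] at hu hu'
    exact hu.2 (hd f hf g hg hfg u hu.1 hu'.1)

/-- Let `p x` be the parent of `x`. If the parents are not all equal, their colouring is pulled back
along `p` and each path gains a hanging edge at both ends, so `ℓ` grows by one. If they coincide,
one vertex is separated from the rest and two hanging edges form a path, so `ℓ = 1`. One colour on
`X` makes the hanging edges distinct; one colour on the parents lets the hypothesis on `M` apply. -/
theorem splits_succ {γ : Type*} {col : α → γ}
    (hcol : ∀ e ∈ E, ∀ u ∈ e, ∀ v ∈ e, col u = col v → u = v)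
    (hsplit : ∀ X ⊆ M, (∀ a ∈ X, ∀ b ∈ X, col a = col b) → 2 ≤ X.card → Splits E S M X t)
    {W : Finset (Finset α)} (hW : W ⊆ leaving E S M)
    (hd : ∀ f ∈ W, ∀ g ∈ W, f ≠ g → ∀ u ∈ f, u ∈ g → u ∈ S ∪ M)
    (hpar : ∀ f ∈ W, ∀ g ∈ W, ∀ p ∈ f, p ∈ M → ∀ q ∈ g, q ∈ M → col p = col q)
    {X : Finset α} (hX : X ⊆ fresh W (S ∪ M)) (hmono : ∀ a ∈ X, ∀ b ∈ X, col a = col b)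
    (hX2 : 2 ≤ X.card) : Splits E (S ∪ M) (fresh W (S ∪ M)) X (t + 1) := by
  obtain ⟨a₀, ha₀, b₀, hb₀, hab₀⟩ := Finset.one_lt_card.1 hX2
  have : Nonempty α := ⟨a₀⟩
  have hex : ∀ x ∈ X, ∃ f ∈ W, x ∈ f ∧ x ∉ S ∪ M := fun x hx => mem_fresh.1 (hX hx)
  choose! f hfW hxf hxT using hex
  have hex' : ∀ x ∈ X, ∃ p ∈ f x, p ∈ M := fun x hx => leaving_exists (hW (hfW x hx))
  choose! p hpf hpM using hex'
  have hpT : ∀ x ∈ X, p x ∈ S ∪ M := fun x hx => Finset.mem_union_right _ (hpM x hx)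
  have hfE : ∀ x ∈ X, f x ∈ E := fun x hx => (Finset.mem_filter.1 (hW (hfW x hx))).1
  have huniq : ∀ x ∈ X, ∀ u ∈ f x, u ∈ S ∪ M → u = p x := fun x hx u hu hu' =>
    leaving_eq (hW (hfW x hx)) hu hu' (hpf x hx) (hpT x hx)
  have hxp : ∀ x ∈ X, x ≠ p x := fun x hx h => hxT x hx (h ▸ hpT x hx)
  have hdis : ∀ x ∈ X, ∀ y ∈ X, x ≠ y → ∀ u ∈ f x, u ∈ f y → u ∈ S ∪ M := by
    intro x hx y hy hxy
    refine hd _ (hfW x hx) _ (hfW y hy) fun h => hxy ?_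
    exact hcol _ (hfE x hx) _ (hxf x hx) _ (h ▸ hxf y hy) (hmono x hx y hy)
  refine ⟨f, fun x hx => ⟨hfE x hx, hxf x hx, ⟨p x, hpf x hx, hpT x hx⟩, fun u hu => ?_⟩, hdis, ?_⟩
  · by_cases h : u ∈ S ∪ M
    · exact Or.inl h
    · exact Or.inr (mem_fresh.2 ⟨f x, hfW x hx, hu, h⟩)
  by_cases hP : 2 ≤ (X.image p).card
  · obtain ⟨g, hg, -, ℓ, χ, hℓ, hℓt, ha, hb, hpath⟩ := hsplit (X.image p)
      (Finset.image_subset_iff.2 hpM) (by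
        intro a ha b hb
        obtain ⟨x, hx, rfl⟩ := Finset.mem_image.1 ha
        obtain ⟨y, hy, rfl⟩ := Finset.mem_image.1 hb
        exact hpar _ (hfW x hx) _ (hfW y hy) _ (hpf x hx) (hpM x hx) _ (hpf y hy) (hpM y hy)) hP
    refine ⟨ℓ + 1, fun x => χ (p x), by omega, by omega, ?_, ?_, ?_⟩
    · obtain ⟨a, ha, h⟩ := ha
      obtain ⟨x, hx, rfl⟩ := Finset.mem_image.1 ha
      exact ⟨x, hx, h⟩
    · obtain ⟨a, ha, h⟩ := hb
      obtain ⟨x, hx, rfl⟩ := Finset.mem_image.1 ha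
      exact ⟨x, hx, h⟩
    · intro a ha b hb hχa hχb
      have ha' := Finset.mem_image_of_mem p ha
      have hb' := Finset.mem_image_of_mem p hb
      obtain ⟨U, hU, hUs⟩ := hpath _ ha' _ hb' hχa hχb
      have hab : a ≠ b := by
        rintro rfl
        exact hχb hχa
      have hUT : ∀ u ∈ U, u ∈ S ∪ M := by
        intro u hu
        rw [Finset.mem_union]
        rcases hUs u hu with h | h | h
        · exact Or.inl h
        · exact (hg _ ha').2.2.2 u h
        · exact (hg _ hb').2.2.2 u h
      have h1 := hU.snoc (hfE b hb) (hpf b hb) (hxf b hb) (hxp b hb)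
        fun u hu hu' => huniq b hb u hu (hUT u hu')
      have h2 := (h1.symm.snoc (hfE a ha) (hpf a ha) (hxf a ha) (hxp a ha) (by
        rintro u hu (hu' | hu')
        · exact huniq a ha u hu (hUT u hu')
        · exact huniq a ha u hu (hdis a ha b hb hab u hu hu'))).symm
      refine ⟨_, h2, ?_⟩
      rintro u ((hu | hu) | hu)
      · exact Or.inl (hUT u hu)
      · exact Or.inr (Or.inr hu)
      · exact Or.inr (Or.inl hu)
  · have hpc : ∀ x ∈ X, ∀ y ∈ X, p x = p y := fun x hx y hy =>
      Finset.card_le_one.1 (by omega : (X.image p).card ≤ 1) _ (Finset.mem_image_of_mem p hx) _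
        (Finset.mem_image_of_mem p hy)
    refine ⟨1, fun x => x = a₀, le_rfl, by omega, ⟨a₀, ha₀, rfl⟩, ⟨b₀, hb₀, hab₀.symm⟩, ?_⟩
    intro a ha b hb hχa hχb
    have hab : a ≠ b := by
      rintro rfl
      exact hχb hχa
    have h1 := (PathBetween.nil (E := E) a).snoc (hfE a ha) (hxf a ha) (hpf a ha) (hxp a ha).symm
      (by simp)
    have h2 := h1.snoc (hfE b hb) (hpc a ha b hb ▸ hpf b hb) (hxf b hb)
      (hpc a ha b hb ▸ hxp b hb) (by
        rintro u hu (hu' | hu')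
        · exact absurd hu' (Set.notMem_empty u)
        · exact huniq a ha u hu' (hdis a ha b hb hab u hu' hu))
    refine ⟨_, h2, ?_⟩
    rintro u ((hu | hu) | hu)
    · exact absurd hu (Set.notMem_empty u)
    · exact Or.inr (Or.inl hu)
    · exact Or.inr (Or.inr hu)

/-! ### Cycles from dense families at the last level -/

section Dense

variable {col : α → Fin r}

/-- The ends are `x e ∈ M` and `y e ∈ N`. Making the ends in `M` monochromatic costs the factor `r`.
-/
theorem cycles_of_leaving_dense (hk : 1 ≤ k) (hr : ∀ e ∈ E, e.card = r) (hr0 : 0 < r)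
    (hlin : ∀ e ∈ E, ∀ g ∈ E, ∀ u v, u ∈ e → u ∈ g → v ∈ e → v ∈ g → u ≠ v → e = g)
    (hsplit : ∀ X ⊆ M, (∀ a ∈ X, ∀ b ∈ X, col a = col b) → 2 ≤ X.card → Splits E S M X t)
    {N : Finset α} (hN : ∀ e ∈ leaving E S M, ∃ u ∈ e, u ∈ N) (hMN : Disjoint M N)
    (hcard : r * (4 * k * r * M.card + 2 * (4 * k * r) * N.card) < (leaving E S M).card) :
    ∃ ℓ, 1 ≤ ℓ ∧ ℓ ≤ t ∧ ∀ i, 1 ≤ i → i ≤ k → HasLinearCycle E r (2 * ℓ + 2 * i) := by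
  have : Nonempty (Fin r) := ⟨⟨0, hr0⟩⟩
  obtain ⟨e₀, he₀⟩ := Finset.card_pos.1 (by omega : 0 < (leaving E S M).card)
  have : Nonempty α := ⟨(hN e₀ he₀).choose⟩
  choose! y hy hyN using hN
  choose! x hx hxM using fun e (he : e ∈ leaving E S M) => leaving_exists he
  obtain ⟨c, hc⟩ := exists_large_fiber (leaving E S M) fun e => col (x e)
  rw [Fintype.card_fin] at hc
  set F := (leaving E S M).filter fun e => col (x e) = c with hFdef
  have hF : F ⊆ leaving E S M := Finset.filter_subset _ _
  refine exists_linear_cycles (F := F) (x := x) (y := y) (S := S) (M := M) hk hr hr0 hlin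
    (hF.trans (Finset.filter_subset _ _)) (fun e he => hx e (hF he)) (fun e he => hy e (hF he))
    (fun e he h => Finset.disjoint_left.1 hMN (hxM e (hF he)) (h ▸ hyN e (hF he)))
    (fun e he => (Finset.mem_filter.1 (hF he)).2.1) ?_ ?_
  · intro X hX h2
    refine hsplit X (hX.trans (Finset.image_subset_iff.2 fun e he => hxM e (hF he))) ?_ h2
    intro a ha b hb
    obtain ⟨e, he, rfl⟩ := Finset.mem_image.1 (hX ha)
    obtain ⟨g, hg, rfl⟩ := Finset.mem_image.1 (hX hb)
    exact (Finset.mem_filter.1 he).2.trans (Finset.mem_filter.1 hg).2.symm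
  · have h1 : (F.image x).card ≤ M.card :=
      Finset.card_le_card (Finset.image_subset_iff.2 fun e he => hxM e (hF he))
    have h2 : (F.image y).card ≤ N.card :=
      Finset.card_le_card (Finset.image_subset_iff.2 fun e he => hyN e (hF he))
    refine lt_of_le_of_lt (Nat.add_le_add (Nat.mul_le_mul_left _ h1) (Nat.mul_le_mul_left _ h2)) ?_
    exact Nat.lt_of_mul_lt_mul_left (hcard.trans_le hc)

/-- Both ends lie among the fresh vertices, one level higher, whence `t + 1`. The factor `r * r`
pays for fixing the colour of `x e` and of its parent; `12 = 4 + 2 * 4` bounds both endpoint sets by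
all fresh vertices. -/
theorem cycles_of_fresh_dense (hk : 1 ≤ k) (hr : ∀ e ∈ E, e.card = r) (hr0 : 0 < r)
    (hlin : ∀ e ∈ E, ∀ g ∈ E, ∀ u v, u ∈ e → u ∈ g → v ∈ e → v ∈ g → u ≠ v → e = g)
    (hcol : ∀ e ∈ E, ∀ u ∈ e, ∀ v ∈ e, col u = col v → u = v)
    (hsplit : ∀ X ⊆ M, (∀ a ∈ X, ∀ b ∈ X, col a = col b) → 2 ≤ X.card → Splits E S M X t)
    {W : Finset (Finset α)} (hW : W ⊆ leaving E S M)
    (hd : ∀ f ∈ W, ∀ g ∈ W, f ≠ g → ∀ u ∈ f, u ∈ g → u ∈ S ∪ M)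
    {F : Finset (Finset α)} (hFE : F ⊆ E) (hFT : ∀ e ∈ F, ∀ u ∈ e, u ∉ S ∪ M)
    (hFN : ∀ e ∈ F, 2 ≤ (e ∩ fresh W (S ∪ M)).card)
    (hcard : r * r * (12 * k * r * (fresh W (S ∪ M)).card) < F.card) :
    ∃ ℓ, 1 ≤ ℓ ∧ ℓ ≤ t + 1 ∧ ∀ i, 1 ≤ i → i ≤ k → HasLinearCycle E r (2 * ℓ + 2 * i) := by
  have : Nonempty (Fin r) := ⟨⟨0, hr0⟩⟩
  have hex : ∀ e ∈ F, ∃ a b, a ∈ e ∧ b ∈ e ∧ a ≠ b ∧ a ∈ fresh W (S ∪ M) ∧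
      b ∈ fresh W (S ∪ M) := by
    intro e he
    obtain ⟨a, ha, b, hb, hab⟩ := Finset.one_lt_card.1 (hFN e he)
    rw [Finset.mem_inter] at ha hb
    exact ⟨a, b, ha.1, hb.1, hab, ha.2, hb.2⟩
  obtain ⟨e₀, he₀⟩ := Finset.card_pos.1 (by omega : 0 < F.card)
  have : Nonempty α := ⟨(hex e₀ he₀).choose⟩
  choose! x y hx hy hxy hxN hyN using hex
  choose! f hfW hxf hxT using fun u (hu : u ∈ fresh W (S ∪ M)) => mem_fresh.1 hu
  choose! p hpf hpM using fun g (hg : g ∈ W) => leaving_exists (hW hg)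
  obtain ⟨⟨c, c'⟩, hc⟩ := exists_large_fiber F fun e => (col (x e), col (p (f (x e))))
  rw [Fintype.card_prod, Fintype.card_fin] at hc
  set F₁ := F.filter fun e => (col (x e), col (p (f (x e)))) = (c, c')
  set W₁ := W.filter fun g => col (p g) = c'
  have hF₁ : F₁ ⊆ F := Finset.filter_subset _ _
  have hW₁ : W₁ ⊆ W := Finset.filter_subset _ _
  have hF₁c : ∀ e ∈ F₁, col (x e) = c ∧ col (p (f (x e))) = c' := fun e he =>
    Prod.mk.inj (Finset.mem_filter.1 he).2
  refine exists_linear_cycles (F := F₁) (x := x) (y := y) (S := S ∪ M)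
    (M := fresh W₁ (S ∪ M)) hk hr hr0 hlin
    (hF₁.trans hFE) (fun e he => hx e (hF₁ he)) (fun e he => hy e (hF₁ he))
    (fun e he => hxy e (hF₁ he)) (fun e he => hFT e (hF₁ he)) ?_ ?_
  · intro X hX h2
    refine splits_succ hcol hsplit (hW₁.trans hW)
      (fun g hg h hh => hd g (hW₁ hg) h (hW₁ hh)) ?_ ?_ ?_ h2
    · have key : ∀ g ∈ W₁, ∀ q ∈ g, q ∈ M → col q = c' := by
        intro g hg q hq hqM
        have hgW := hW₁ hg
        rw [leaving_eq (hW hgW) hq (Finset.mem_union_right _ hqM) (hpf g hgW)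
          (Finset.mem_union_right _ (hpM g hgW))]
        exact (Finset.mem_filter.1 hg).2
      intro g hg h hh q hq hqM q' hq' hqM'
      rw [key g hg q hq hqM, key h hh q' hq' hqM']
    · intro u hu
      obtain ⟨e, he, rfl⟩ := Finset.mem_image.1 (hX hu)
      have hN := hxN e (hF₁ he)
      exact mem_fresh.2 ⟨f (x e), Finset.mem_filter.2 ⟨hfW _ hN, (hF₁c e he).2⟩, hxf _ hN,
        hxT _ hN⟩
    · intro a ha b hb
      obtain ⟨e, he, rfl⟩ := Finset.mem_image.1 (hX ha)
      obtain ⟨g, hg, rfl⟩ := Finset.mem_image.1 (hX hb)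
      rw [(hF₁c e he).1, (hF₁c g hg).1]
  · have h1 : (F₁.image x).card ≤ (fresh W (S ∪ M)).card :=
      Finset.card_le_card (Finset.image_subset_iff.2 fun e he => hxN e (hF₁ he))
    have h2 : (F₁.image y).card ≤ (fresh W (S ∪ M)).card :=
      Finset.card_le_card (Finset.image_subset_iff.2 fun e he => hyN e (hF₁ he))
    refine lt_of_le_of_lt (Nat.add_le_add (Nat.mul_le_mul_left _ h1) (Nat.mul_le_mul_left _ h2)) ?_
    refine Nat.lt_of_mul_lt_mul_left (a := r * r) (lt_of_eq_of_lt ?_ (hcard.trans_le hc))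
    ring

end Dense

end LinearCycles

/-! ### Growing the tree until cycles appear -/

namespace LinearCycles

variable {α : Type*} [DecidableEq α] {E : Finset (Finset α)} {S M : Finset α} {k r t : ℕ}
  {col : α → Fin r}

/-- The last level `M` and the earlier levels `S` of a tree of height `t` in `E` whose levels grow
by a factor of `D`, and which few edges meet more often than they have to. -/
structure TreeLevel (E : Finset (Finset α)) (col : α → Fin r) (κ : ℕ) (D : ℝ) (t : ℕ)
    (S M : Finset α) : Prop where
  subset : M ⊆ E.biUnion id
  splits : ∀ X ⊆ M, (∀ a ∈ X, ∀ b ∈ X, col a = col b) → 2 ≤ X.card → Splits E S M X t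
  crowded_le : (crowded E S (S ∪ M)).card ≤ 30 * κ * M.card
  growth : D ^ t ≤ M.card

theorem TreeLevel.zero {κ : ℕ} {D : ℝ} {a : α} (ha : a ∈ E.biUnion id) :
    TreeLevel E col κ D 0 ∅ {a} := by
  refine ⟨by simpa using ha, ?_, ?_, by simp⟩
  · intro X hX _ h2
    have := Finset.card_le_card hX
    rw [Finset.card_singleton] at this
    omega
  · have : crowded E ∅ (∅ ∪ {a}) = ∅ := by
      refine Finset.filter_eq_empty_iff.2 fun e _ => ?_
      rintro (⟨u, -, hu⟩ | h)
      · exact absurd hu (Finset.notMem_empty u)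
      · have := h.trans (Finset.card_le_card Finset.inter_subset_right)
        simp at this
    rw [this]
    simp

/-- The alternative depends on the number of edges meeting the enlarged tree `S ∪ M ∪ N` twice. If
they are few, the next level inherits the crowding bound. Otherwise, since old crowded edges are
few, the excess consists of leaving edges or of edges with two vertices in `N`, and one of these
families is dense. -/
theorem TreeLevel.step (hk : 1 ≤ k) (hr3 : 3 ≤ r) (hr : ∀ e ∈ E, e.card = r)
    (hlin : ∀ e ∈ E, ∀ g ∈ E, ∀ u v, u ∈ e → u ∈ g → v ∈ e → v ∈ g → u ≠ v → e = g)
    (hcol : ∀ e ∈ E, ∀ u ∈ e, ∀ v ∈ e, col u = col v → u = v) {κ : ℕ} (hκ : κ = k * r ^ (r + 1))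
    {D δ : ℝ} (hD : 6 ≤ D) (hDδ : 30 * κ * (D + r) ≤ δ)
    (hδ : ∀ v ∈ E.biUnion id, δ ≤ ((E.filter fun e => v ∈ e).card : ℝ))
    (h : TreeLevel E col κ D t S M) :
    (∃ S' M', TreeLevel E col κ D (t + 1) S' M') ∨
      ∃ ℓ, 1 ≤ ℓ ∧ D ^ ℓ < (E.biUnion id).card ∧
        ∀ i, 1 ≤ i → i ≤ k → HasLinearCycle E r (2 * ℓ + 2 * i) := by
  -- This lower bound is all that the density estimates need from the value of `κ`.
  have hκ4 : k * r ^ 4 ≤ κ := by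
    rw [hκ]
    exact Nat.mul_le_mul_left k (Nat.pow_le_pow_right (by omega) (by omega))
  have hκ0 : 0 < κ := lt_of_lt_of_le (by positivity) hκ4
  have hM0 : (1 : ℝ) ≤ M.card := (one_le_pow₀ (by linarith : (1 : ℝ) ≤ D)).trans h.growth
  obtain ⟨W, hW, hd, hmax⟩ := exists_maximal_disjoint (S := S) (M := M) hr (by omega : 2 ≤ r)
  set N := fresh W (S ∪ M) with hN
  have hNcard : N.card = (r - 1) * W.card := card_fresh hr hW hd
  have hNE : N ⊆ E.biUnion id := by
    intro u hu
    obtain ⟨f, hf, huf, -⟩ := mem_fresh.1 hu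
    exact Finset.mem_biUnion.2 ⟨f, (Finset.mem_filter.1 (hW hf)).1, huf⟩
  have hSN : Disjoint (S ∪ M) N := by
    rw [Finset.disjoint_right]
    intro u hu
    obtain ⟨f, hf, -, h⟩ := mem_fresh.1 hu
    exact h
  have hMN : Disjoint M N := hSN.mono_left Finset.subset_union_right
  have hMNV : M.card + N.card ≤ (E.biUnion id).card := by
    rw [← Finset.card_union_of_disjoint hMN]
    exact Finset.card_le_card (Finset.union_subset h.subset hNE)
  set E₂ := E.filter fun e => 2 ≤ (e ∩ (S ∪ M ∪ N)).card with hE₂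
  have hlE₂ : leaving E S M ⊆ E₂ := by
    intro e he
    refine Finset.mem_filter.2 ⟨(Finset.mem_filter.1 he).1, ?_⟩
    obtain ⟨p, hp, hpM⟩ := leaving_exists he
    obtain ⟨u, hu, huN⟩ := hmax e he
    refine Finset.one_lt_card.2 ⟨p, ?_, u, ?_, ?_⟩
    · exact Finset.mem_inter.2
        ⟨hp, Finset.mem_union_left _ (Finset.mem_union_right _ hpM)⟩
    · exact Finset.mem_inter.2 ⟨hu, Finset.mem_union_right _ huN⟩
    · rintro rfl
      exact Finset.disjoint_left.1 hMN hpM huN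
  have hcr : ((crowded E S (S ∪ M)).card : ℝ) ≤ 30 * κ * M.card := by
    exact_mod_cast h.crowded_le
  have hlv : 30 * κ * (D * M.card) ≤ ((leaving E S M).card : ℝ) := by
    have h1 := degree_sum_le (S := S) hr fun v hv => hδ v (h.subset hv)
    have h2 := mul_le_mul_of_nonneg_right hDδ (Nat.cast_nonneg (α := ℝ) M.card)
    have h3 := mul_le_mul_of_nonneg_left hcr (Nat.cast_nonneg (α := ℝ) r)
    linarith
  have hκM : 6 * (κ * M.card : ℝ) ≤ κ * (D * M.card) := by
    have : (0 : ℝ) ≤ κ * M.card := by positivity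
    nlinarith
  have hκR : (0 : ℝ) < κ := by exact_mod_cast hκ0
  by_cases hsparse : E₂.card ≤ 17 * κ * W.card
  · left
    have hr0 : Nonempty (Fin r) := ⟨⟨0, by omega⟩⟩
    have : Nonempty α := by
      obtain ⟨u, -⟩ := Finset.card_pos.1 (show 0 < M.card by exact_mod_cast one_pos.trans_le hM0)
      exact ⟨u⟩
    choose! p hpf hpM using fun g (hg : g ∈ W) => leaving_exists (hW hg)
    -- Keeping only edges whose vertex in `M` has the majority colour gives the next level
    -- monochromatic parents.
    obtain ⟨c, hc⟩ := exists_large_fiber W fun g => col (p g)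
    rw [Fintype.card_fin] at hc
    set W' := W.filter fun g => col (p g) = c
    have hW' : W' ⊆ W := Finset.filter_subset _ _
    have hd' : ∀ f ∈ W', ∀ g ∈ W', f ≠ g → ∀ u ∈ f, u ∈ g → u ∈ S ∪ M :=
      fun f hf g hg => hd f (hW' hf) g (hW' hg)
    have hNN : fresh W' (S ∪ M) ⊆ N := Finset.biUnion_subset_biUnion_of_subset_left _ hW'
    have hcard := card_fresh hr (hW'.trans hW) hd'
    set M' := fresh W' (S ∪ M)
    -- `|M'| ≥ (r - 1)|W| / r ≥ 2|W| / 3`.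
    have hwM : 2 * (W.card : ℝ) ≤ 3 * M'.card := by
      have : 2 * W.card ≤ 3 * M'.card := by
        rw [hcard]
        obtain ⟨s, rfl⟩ := Nat.exists_eq_add_of_le hr3
        rw [show 3 + s - 1 = s + 2 by omega]
        nlinarith [Nat.zero_le (s * W'.card)]
      exact_mod_cast this
    have h17 : (E₂.card : ℝ) ≤ 17 * κ * W.card := by exact_mod_cast hsparse
    have hle : ((leaving E S M).card : ℝ) ≤ E₂.card := by
      exact_mod_cast Finset.card_le_card hlE₂
    have hκw : 2 * (κ * W.card : ℝ) ≤ 3 * (κ * M'.card) := by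
      have := mul_le_mul_of_nonneg_left hwM hκR.le
      linarith
    refine ⟨S ∪ M, M', hNN.trans hNE, ?_, ?_, ?_⟩
    · intro X hX hmono h2
      refine splits_succ hcol h.splits (hW'.trans hW) hd' ?_ hX hmono h2
      have key : ∀ g ∈ W', ∀ q ∈ g, q ∈ M → col q = c := by
        intro g hg q hq hqM
        have hgW := hW' hg
        rw [leaving_eq (hW hgW) hq (Finset.mem_union_right _ hqM) (hpf g hgW)
          (Finset.mem_union_right _ (hpM g hgW))]
        exact (Finset.mem_filter.1 hg).2
      intro g hg h hh q hq hqM q' hq' hqM'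
      rw [key g hg q hq hqM, key h hh q' hq' hqM']
    · have hsub : crowded E (S ∪ M) (S ∪ M ∪ M') ⊆ crowded E S (S ∪ M) ∪ E₂ := by
        intro e he
        obtain ⟨heE, he⟩ := Finset.mem_filter.1 he
        rw [Finset.mem_union]
        rcases he with ⟨u, hu, huT⟩ | h2
        · by_cases hcw : e ∈ crowded E S (S ∪ M)
          · exact Or.inl hcw
          · right
            have hnot : ¬ ((∃ u ∈ e, u ∈ S) ∨ 2 ≤ (e ∩ (S ∪ M)).card) := fun h =>
              hcw (Finset.mem_filter.2 ⟨heE, h⟩)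
            push Not at hnot
            refine hlE₂ (Finset.mem_filter.2 ⟨heE, hnot.1, ?_⟩)
            have huM : u ∈ M := (Finset.mem_union.1 huT).resolve_left (hnot.1 u hu)
            have h1 : (e ∩ M).card ≤ (e ∩ (S ∪ M)).card :=
              Finset.card_le_card (Finset.inter_subset_inter_left Finset.subset_union_right)
            have h2 : 0 < (e ∩ M).card :=
              Finset.card_pos.2 ⟨u, Finset.mem_inter.2 ⟨hu, huM⟩⟩
            omega
        · exact Or.inr (Finset.mem_filter.2 ⟨heE, h2.trans (Finset.card_le_card
            (Finset.inter_subset_inter_left (Finset.union_subset_union_right hNN)))⟩)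
      have h1 : ((crowded E (S ∪ M) (S ∪ M ∪ M')).card : ℝ) ≤
          (crowded E S (S ∪ M)).card + E₂.card := by
        exact_mod_cast (Finset.card_le_card hsub).trans (Finset.card_union_le _ _)
      -- `|E₂| ≤ 17κ|W| ≤ 25.5κ|M'|`, and the old crowded edges number at most `30κ|M| ≤ 5κD|M|`, a
      -- sixth of the bound for leaving edges and so at most `|E₂| / 6`. The total is at most
      -- `29.75κ|M'|`.
      have h2 : ((crowded E (S ∪ M) (S ∪ M ∪ M')).card : ℝ) ≤ 30 * κ * M'.card := by linarith
      exact_mod_cast h2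
    · have h1 : κ * (D * M.card) ≤ κ * (M'.card : ℝ) := by
        have : (0 : ℝ) ≤ κ * M'.card := by positivity
        linarith
      have h2 : D * M.card ≤ (M'.card : ℝ) := le_of_mul_le_mul_left h1 hκR
      rw [pow_succ']
      exact (mul_le_mul_of_nonneg_left h.growth (by linarith)).trans h2
  · right
    push Not at hsparse
    have hsparse' : 17 * κ * (W.card : ℝ) < E₂.card := by exact_mod_cast hsparse
    have hlpos : 0 < (leaving E S M).card := by
      have : (0 : ℝ) < (leaving E S M).card := by
        have : (0 : ℝ) < κ * M.card := by positivity
        linarith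
      exact_mod_cast this
    have hWpos : 0 < W.card := by
      obtain ⟨e, he⟩ := Finset.card_pos.1 hlpos
      obtain ⟨u, -, hu⟩ := hmax e he
      obtain ⟨f, hf, -⟩ := mem_fresh.1 hu
      exact Finset.card_pos.2 ⟨f, hf⟩
    have hWN : W.card ≤ N.card := by
      rw [hNcard]
      exact Nat.le_mul_of_pos_left _ (by omega)
    have hD1 : 1 ≤ D := by linarith
    by_cases hI : κ * M.card + 2 * κ * W.card ≤ (leaving E S M).card
    · obtain ⟨ℓ, h1, h2, h3⟩ := cycles_of_leaving_dense hk hr (by omega) hlin h.splits hmax hMN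
        (by
          refine lt_of_lt_of_le ?_ hI
          have e1 : r * (4 * k * r * M.card) < κ * M.card := by
            have hMpos : 0 < M.card := by exact_mod_cast one_pos.trans_le hM0
            rw [← mul_assoc]
            refine Nat.mul_lt_mul_of_pos_right (lt_of_lt_of_le ?_ hκ4) hMpos
            have : 4 * (k * (r * r)) < r * r * (k * (r * r)) :=
              Nat.mul_lt_mul_of_pos_right (by nlinarith) (by positivity)
            nlinarith
          have e2 : r * (2 * (4 * k * r) * N.card) ≤ 2 * κ * W.card := by
            rw [hNcard, ← mul_assoc, ← mul_assoc]
            refine Nat.mul_le_mul_right _ (le_trans ?_ (Nat.mul_le_mul_left 2 hκ4))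
            obtain ⟨s, rfl⟩ := Nat.exists_eq_add_of_le hr3
            rw [show 3 + s - 1 = s + 2 by omega]
            have : 4 * (s + 2) ≤ (3 + s) * (3 + s) := by nlinarith
            have := Nat.mul_le_mul_left (2 * k * ((3 + s) * (3 + s))) this
            nlinarith
          rw [Nat.mul_add]
          omega)
      refine ⟨ℓ, h1, ?_, h3⟩
      calc D ^ ℓ ≤ D ^ t := pow_le_pow_right₀ hD1 h2
        _ ≤ M.card := h.growth
        _ < (E.biUnion id).card := by exact_mod_cast (by omega : M.card < (E.biUnion id).card)
    · push Not at hI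
      have hI' : ((leaving E S M).card : ℝ) < κ * M.card + 2 * κ * W.card := by
        exact_mod_cast hI
      set F := E.filter fun e => (∀ u ∈ e, u ∉ S ∪ M) ∧ 2 ≤ (e ∩ N).card with hF
      have hsub : E₂ ⊆ crowded E S (S ∪ M) ∪ leaving E S M ∪ F := by
        intro e he
        obtain ⟨heE, he2⟩ := Finset.mem_filter.1 he
        by_contra hno
        simp only [Finset.mem_union, not_or] at hno
        obtain ⟨⟨hno1, hno2⟩, hno3⟩ := hno
        have hnot : ¬ ((∃ u ∈ e, u ∈ S) ∨ 2 ≤ (e ∩ (S ∪ M)).card) := fun h =>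
          hno1 (Finset.mem_filter.2 ⟨heE, h⟩)
        push Not at hnot
        have hM1 : (e ∩ M).card ≤ (e ∩ (S ∪ M)).card :=
          Finset.card_le_card (Finset.inter_subset_inter_left Finset.subset_union_right)
        have hM2 : (e ∩ M).card ≠ 1 := fun h => hno2 (Finset.mem_filter.2 ⟨heE, hnot.1, h⟩)
        have hM3 : e ∩ M = ∅ := Finset.card_eq_zero.1 (by omega)
        have hT : ∀ u ∈ e, u ∉ S ∪ M := by
          intro u hu huT
          have huM : u ∈ M := (Finset.mem_union.1 huT).resolve_left (hnot.1 u hu)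
          exact Finset.notMem_empty u (hM3 ▸ Finset.mem_inter.2 ⟨hu, huM⟩)
        refine hno3 (Finset.mem_filter.2 ⟨heE, hT, he2.trans (Finset.card_le_card ?_)⟩)
        intro u hu
        rw [Finset.mem_inter] at hu ⊢
        exact ⟨hu.1, (Finset.mem_union.1 hu.2).resolve_left (hT u hu.1)⟩
      have hcount : (E₂.card : ℝ) ≤ (crowded E S (S ∪ M)).card + (leaving E S M).card + F.card := by
        have h1 := Finset.card_le_card hsub
        have h2 := Finset.card_union_le (crowded E S (S ∪ M) ∪ leaving E S M) F
        have h3 := Finset.card_union_le (crowded E S (S ∪ M)) (leaving E S M)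
        exact_mod_cast (by omega : E₂.card ≤
          (crowded E S (S ∪ M)).card + (leaving E S M).card + F.card)
      -- From `17κ|W|` one subtracts `30κ|M|` and `κ|M| + 2κ|W|`. As `30κD|M|` is below the latter
      -- sum and `D ≥ 6`, the terms `31κ|M|` cost at most `κ|W|`.
      have hF14 : 14 * κ * (W.card : ℝ) ≤ F.card := by linarith
      have hF14' : 14 * κ * W.card ≤ F.card := by exact_mod_cast hF14
      have hDW : D * M.card < W.card := by
        have : κ * (D * M.card) < κ * (W.card : ℝ) := by
          have : (0 : ℝ) ≤ κ * W.card := by positivity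
          have : (0 : ℝ) < κ * M.card := by positivity
          linarith
        exact lt_of_mul_lt_mul_left this hκR.le
      obtain ⟨ℓ, h1, h2, h3⟩ := cycles_of_fresh_dense hk hr (by omega) hlin hcol h.splits hW hd
        (Finset.filter_subset _ _ : F ⊆ E) (fun e he => (Finset.mem_filter.1 he).2.1)
        (fun e he => (Finset.mem_filter.1 he).2.2) (by
          refine lt_of_lt_of_le ?_ hF14'
          rw [← hN, hNcard]
          have e1 : r * r * (12 * k * r * ((r - 1) * W.card)) ≤ 12 * κ * W.card := by
            rw [← mul_assoc, ← mul_assoc]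
            refine Nat.mul_le_mul_right _ (le_trans ?_ (Nat.mul_le_mul_left 12 hκ4))
            calc r * r * (12 * k * r) * (r - 1) = 12 * k * (r * r * r) * (r - 1) := by ring
              _ ≤ 12 * k * (r * r * r) * r := Nat.mul_le_mul_left _ (Nat.sub_le r 1)
              _ = 12 * (k * r ^ 4) := by ring
          have e2 : 0 < κ * W.card := Nat.mul_pos hκ0 hWpos
          refine e1.trans_lt ?_
          rw [mul_assoc, mul_assoc]
          omega)
      refine ⟨ℓ, h1, ?_, h3⟩
      calc D ^ ℓ ≤ D ^ (t + 1) := pow_le_pow_right₀ hD1 h2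
        _ = D * D ^ t := pow_succ' _ _
        _ ≤ D * M.card := mul_le_mul_of_nonneg_left h.growth (by linarith)
        _ < W.card := hDW
        _ ≤ (E.biUnion id).card := by exact_mod_cast (by omega : W.card ≤ (E.biUnion id).card)

theorem exists_cycles_of_minDegree (hk : 1 ≤ k) (hr3 : 3 ≤ r) (hr : ∀ e ∈ E, e.card = r)
    (hlin : ∀ e ∈ E, ∀ g ∈ E, ∀ u v, u ∈ e → u ∈ g → v ∈ e → v ∈ g → u ≠ v → e = g)
    (hcol : ∀ e ∈ E, ∀ u ∈ e, ∀ v ∈ e, col u = col v → u = v)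
    {D δ : ℝ} (hD : 6 ≤ D) (hDδ : 30 * (k * r ^ (r + 1)) * (D + r) ≤ δ)
    (hδ : ∀ v ∈ E.biUnion id, δ ≤ ((E.filter fun e => v ∈ e).card : ℝ)) (hE : E.Nonempty) :
    ∃ ℓ, 1 ≤ ℓ ∧ D ^ ℓ < (E.biUnion id).card ∧
      ∀ i, 1 ≤ i → i ≤ k → HasLinearCycle E r (2 * ℓ + 2 * i) := by
  by_contra hno
  obtain ⟨e, he⟩ := hE
  obtain ⟨a, ha⟩ := Finset.card_pos.1 (by rw [hr e he]; omega : 0 < e.card)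
  have hall : ∀ t, ∃ S M, TreeLevel E col (k * r ^ (r + 1)) D t S M := by
    intro t
    induction t with
    | zero => exact ⟨∅, {a}, TreeLevel.zero (Finset.mem_biUnion.2 ⟨e, he, ha⟩)⟩
    | succ t ih =>
      obtain ⟨S, M, h⟩ := ih
      exact (h.step hk hr3 hr hlin hcol rfl hD (by push_cast; exact hDδ) hδ).resolve_right hno
  -- At height `t` equal to the number of vertices, `D ^ t ≥ 2 ^ t > t` is absurd.
  obtain ⟨S, M, h⟩ := hall (E.biUnion id).card
  have h1 : (M.card : ℝ) ≤ (E.biUnion id).card := by exact_mod_cast Finset.card_le_card h.subset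
  have h2 : (2 : ℝ) ^ (E.biUnion id).card ≤ D ^ (E.biUnion id).card :=
    pow_le_pow_left₀ (by norm_num) (by linarith) _
  have h3 : ((E.biUnion id).card : ℝ) < 2 ^ (E.biUnion id).card := by
    exact_mod_cast Nat.lt_two_pow_self
  linarith [h.growth]

/-! ### Minimum degree, and translation to hypergraphs -/

/-- Deleting a vertex of degree below `δ` with its edges loses fewer than `δ` edges and at least one
covered vertex. The inequality survives strictly, so edges remain. -/
theorem exists_minDegree_subfamily {δ : ℝ} (hδ : 0 < δ) (hE : E.Nonempty)
    (h : δ * (E.biUnion id).card ≤ E.card) :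
    ∃ E' ⊆ E, E'.Nonempty ∧
      ∀ v ∈ E'.biUnion id, δ ≤ ((E'.filter fun e => v ∈ e).card : ℝ) := by
  induction E using Finset.strongInduction with
  | H E ih =>
    by_cases hmin : ∀ v ∈ E.biUnion id, δ ≤ ((E.filter fun e => v ∈ e).card : ℝ)
    · exact ⟨E, subset_rfl, hE, hmin⟩
    push Not at hmin
    obtain ⟨v, hv, hlt⟩ := hmin
    have hsub : (E.filter fun e => v ∉ e) ⊂ E := by
      obtain ⟨e, he, hve⟩ := Finset.mem_biUnion.1 hv
      exact Finset.filter_ssubset.2 ⟨e, he, not_not.2 hve⟩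
    have h1 : ((E.filter fun e => v ∈ e).card : ℝ) + (E.filter fun e => v ∉ e).card = E.card := by
      exact_mod_cast Finset.card_filter_add_card_filter_not (s := E) (fun e => v ∈ e)
    have h2 : (((E.filter fun e => v ∉ e).biUnion id).card : ℝ) + 1 ≤ (E.biUnion id).card := by
      have : ((E.filter fun e => v ∉ e).biUnion id).card < (E.biUnion id).card := by
        refine Finset.card_lt_card (Finset.ssubset_iff_of_subset
          (Finset.biUnion_subset_biUnion_of_subset_left _ hsub.1) |>.2 ⟨v, hv, ?_⟩)
        simp
      exact_mod_cast this
    have h3 : δ * (((E.filter fun e => v ∉ e).biUnion id).card : ℝ) <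
        (E.filter fun e => v ∉ e).card := by
      have := mul_le_mul_of_nonneg_left h2 hδ.le
      linarith
    have h4 : 0 < (E.filter fun e => v ∉ e).card := by
      have : (0 : ℝ) < (E.filter fun e => v ∉ e).card := lt_of_le_of_lt (by positivity) h3
      exact_mod_cast this
    obtain ⟨E', hE', h5⟩ := ih _ hsub (Finset.card_pos.1 h4) h3.le
    exact ⟨E', hE'.trans hsub.1, h5⟩

theorem HasLinearCycle.containsLinearCycle {G : Hypergraph α} {m : ℕ} (h : HasLinearCycle E r m)
    (hE : ∀ e ∈ E, (e : Set α) ∈ G.edgeSet) (hr : ∀ e ∈ E, e.card = r) :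
    G.ContainsLinearCycle r m := by
  obtain ⟨hm, e, hinj, he, hcard, hcons, hdisj⟩ := h
  refine ⟨hm, fun i => (e i : Set α), fun i j hij => hinj (Finset.coe_injective hij),
    fun i => ⟨hE _ (he i), by rw [Set.ncard_coe_finset, hr _ (he i)]⟩, ?_, ?_, ?_⟩
  · rw [← hcard, ← Set.ncard_coe_finset]
    congr 1
    ext u
    simp
  · intro i j hij
    rw [← Finset.coe_inter, Set.ncard_coe_finset, hcons i j hij]
  · intro i j hij h1 h2
    exact Finset.disjoint_coe.2 (hdisj i j hij h1 h2)

theorem averageDegree_eq {G : Hypergraph α} {V : Finset α} (hV : (V : Set α) = G.vertexSet)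
    (hE : ∀ e : Finset α, e ∈ E ↔ (e : Set α) ∈ G.edgeSet) (hr : ∀ e ∈ E, e.card = r) :
    G.averageDegree = r * E.card / V.card := by
  have hsub : ∀ e ∈ G.edgeSet, ∃ f ∈ E, (f : Set α) = e := by
    intro e he
    have hfin : e.Finite := V.finite_toSet.subset
      (hV ▸ G.subset_vertexSet_of_mem_edgeSet' he)
    refine ⟨hfin.toFinset, (hE _).2 ?_, hfin.coe_toFinset⟩
    rwa [hfin.coe_toFinset]
  have hdeg : ∀ v, G.degree v = (E.filter fun e => v ∈ e).card := by
    intro v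
    rw [Hypergraph.degree, ← Set.ncard_coe_finset,
      ← Set.ncard_image_of_injective _ (Finset.coe_injective (α := α))]
    congr 1
    ext e
    constructor
    · rintro ⟨he, hve⟩
      obtain ⟨f, hf, rfl⟩ := hsub e he
      exact ⟨f, by simpa using ⟨hf, hve⟩, rfl⟩
    · rintro ⟨f, hf, rfl⟩
      simp only [Finset.coe_filter, Set.mem_ofPred_eq] at hf
      exact ⟨(hE f).1 hf.1, hf.2⟩
  have hsum : ∑ v ∈ V, (E.filter fun e => v ∈ e).card = r * E.card := by
    simp only [Finset.card_filter]
    rw [Finset.sum_comm, Finset.sum_congr rfl (g := fun _ => r)]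
    · simp [mul_comm]
    · intro e he
      rw [← Finset.card_filter, Finset.filter_mem_eq_inter, Finset.inter_eq_right.2, hr e he]
      intro u hu
      have := G.subset_vertexSet_of_mem_edgeSet' ((hE e).1 he) hu
      rwa [← hV] at this
  rw [Hypergraph.averageDegree, ← hV, finsum_mem_coe_finset, Set.ncard_coe_finset]
  congr 1
  simp only [hdeg]
  exact_mod_cast hsum

end LinearCycles

theorem mainTheorem2 {α : Type*} (k r : ℕ) (hk : 1 ≤ k) (hr : 3 ≤ r)
    (G : Hypergraph α) (hfin : G.vertexSet.Finite)
    (hG : G.IsRGraph r) (hlin : G.IsLinear) (hpart : G.IsRPartite r)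
    (hdeg : 128 * (r : ℝ) ^ (r + 3) * (k : ℝ) ≤ G.averageDegree) :
    ∃ ℓ : ℕ, 0 < ℓ ∧
      (ℓ : ℤ) ≤ ⌈Real.logb 2 (G.vertexSet.ncard : ℝ) /
        (Real.logb 2 (G.averageDegree / (k : ℝ)) -
          Real.logb 2 (64 * (r : ℝ) ^ (r + 2)))⌉ - 1 ∧
      ∀ i : ℕ, 1 ≤ i → i ≤ k → G.ContainsLinearCycle r (2 * ℓ + 2 * i) := by
  classical
  set V := hfin.toFinset with hVdef
  have hV : (V : Set α) = G.vertexSet := hfin.coe_toFinset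
  set E : Finset (Finset α) := V.powerset.filter fun e => (e : Set α) ∈ G.edgeSet with hEdef
  have hE : ∀ e : Finset α, e ∈ E ↔ (e : Set α) ∈ G.edgeSet := by
    intro e
    rw [hEdef, Finset.mem_filter, Finset.mem_powerset, and_iff_right_iff_imp]
    intro he
    rw [← Finset.coe_subset, hV]
    exact G.subset_vertexSet_of_mem_edgeSet' he
  have hEr : ∀ e ∈ E, e.card = r := by
    intro e he
    rw [← Set.ncard_coe_finset, hG _ ((hE e).1 he)]
  have hElin : ∀ e ∈ E, ∀ g ∈ E, ∀ u v, u ∈ e → u ∈ g → v ∈ e → v ∈ g → u ≠ v → e = g := by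
    intro e he g hg u v hue hug hve hvg huv
    by_contra hne
    have h1 := hlin _ ((hE e).1 he) _ ((hE g).1 hg) fun h => hne (Finset.coe_injective h)
    rw [← Finset.coe_inter, Set.ncard_coe_finset] at h1
    exact huv (Finset.card_le_one.1 h1 _ (Finset.mem_inter.2 ⟨hue, hug⟩) _
      (Finset.mem_inter.2 ⟨hve, hvg⟩))
  obtain ⟨A, -, hA, hAe⟩ := hpart
  have hEV : ∀ e ∈ E, ∀ u ∈ e, ∃ i, u ∈ A i := by
    intro e he u hu
    have := G.subset_vertexSet_of_mem_edgeSet' ((hE e).1 he) hu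
    rw [← hA] at this
    exact Set.mem_iUnion.1 this
  obtain ⟨col, hcolA⟩ : ∃ col : α → Fin r, ∀ u, (∃ i, u ∈ A i) → u ∈ A (col u) := by
    have : Nonempty (Fin r) := ⟨⟨0, by omega⟩⟩
    -- The parts of the partition serve as colours; vertices of one colour never share an edge.
    choose! col hcol using fun u (hu : ∃ i, u ∈ A i) => hu
    exact ⟨col, hcol⟩
  have hcol : ∀ e ∈ E, ∀ u ∈ e, ∀ v ∈ e, col u = col v → u = v := by
    intro e he u hu v hv huv
    obtain ⟨w, hw⟩ := Set.ncard_eq_one.1 (hAe _ ((hE e).1 he) (col u))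
    have h1 : u ∈ (e : Set α) ∩ A (col u) := ⟨hu, hcolA u (hEV e he u hu)⟩
    have h2 : v ∈ (e : Set α) ∩ A (col u) := ⟨hv, huv ▸ hcolA v (hEV e he v hv)⟩
    rw [hw] at h1 h2
    exact h1.trans h2.symm
  have hd := LinearCycles.averageDegree_eq hV hE hEr
  set d := G.averageDegree
  have hr0 : (0 : ℝ) < r := by exact_mod_cast (by omega : 0 < r)
  have hr3 : (3 : ℝ) ≤ r := by exact_mod_cast hr
  have hk0 : (0 : ℝ) < k := by exact_mod_cast hk
  have hd0 : 0 < d := lt_of_lt_of_le (by positivity) hdeg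
  have hV0 : (0 : ℝ) < V.card := by
    rcases Nat.eq_zero_or_pos V.card with h | h
    · rw [hd, h] at hd0
      simp at hd0
    · exact_mod_cast h
  have hEd : d / r * V.card = E.card := by
    rw [hd]
    field_simp
  have hEne : E.Nonempty := by
    have : (0 : ℝ) < E.card := hEd ▸ by positivity
    exact Finset.card_pos.1 (by exact_mod_cast this)
  have hVE : E.biUnion id ⊆ V := by
    intro u hu
    obtain ⟨e, he, hu⟩ := Finset.mem_biUnion.1 hu
    exact Finset.mem_powerset.1 (Finset.mem_filter.1 he).1 hu
  obtain ⟨E', hE', hE'ne, hmin⟩ := LinearCycles.exists_minDegree_subfamily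
    (δ := d / r) (by positivity) hEne (by
      rw [← hEd]
      have : ((E.biUnion id).card : ℝ) ≤ V.card := by exact_mod_cast Finset.card_le_card hVE
      gcongr)
  set D := d / k / (64 * (r : ℝ) ^ (r + 2)) with hDdef
  have hdD : d = 64 * (r : ℝ) ^ (r + 2) * k * D := by
    rw [hDdef]
    field_simp
  have hDr : 2 * (r : ℝ) ≤ D := by
    rw [hDdef, div_div, le_div_iff₀ (by positivity)]
    refine le_of_eq_of_le ?_ hdeg
    ring
  obtain ⟨ℓ, hℓ, hDℓ, hcyc⟩ := LinearCycles.exists_cycles_of_minDegree (E := E') (col := col)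
    (D := D) hk hr (fun e he => hEr e (hE' he))
    (fun e he g hg => hElin e (hE' he) g (hE' hg)) (fun e he => hcol e (hE' he)) (by linarith)
    (by
      rw [le_div_iff₀ hr0, hdD]
      have h1 : (0 : ℝ) ≤ k * r ^ (r + 2) := by positivity
      -- `D ≥ 2r` gives `30(D + r) ≤ 45D`.
      have h2 : 30 * (D + r) ≤ 64 * D := by linarith
      calc 30 * ((k : ℝ) * r ^ (r + 1)) * (D + r) * r = k * r ^ (r + 2) * (30 * (D + r)) := by ring
        _ ≤ k * r ^ (r + 2) * (64 * D) := mul_le_mul_of_nonneg_left h2 h1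
        _ = 64 * (r : ℝ) ^ (r + 2) * k * D := by ring) hmin hE'ne
  refine ⟨ℓ, hℓ, ?_, fun i hi hik => (hcyc i hi hik).containsLinearCycle
    (fun e he => (hE e).1 (hE' he)) fun e he => hEr e (hE' he)⟩
  have hD1 : 1 < D := by linarith
  -- The denominator is `logb 2 D`, and `ℓ ≤ ⌈z⌉ - 1` means `ℓ < z`; the claim becomes `D ^ ℓ < n`.
  rw [← Real.logb_div (by positivity) (by positivity), ← hDdef, Int.le_sub_one_iff, Int.lt_ceil,
    lt_div_iff₀ (Real.logb_pos (by norm_num) hD1), ← hV, Set.ncard_coe_finset]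
  have h1 : D ^ ℓ < V.card := by
    refine hDℓ.trans_le ?_
    exact_mod_cast Finset.card_le_card
      ((Finset.biUnion_subset_biUnion_of_subset_left _ hE').trans hVE)
  have h2 := Real.logb_lt_logb (b := 2) (by norm_num) (by positivity) h1
  rw [Real.logb_pow] at h2
  exact_mod_cast h2
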